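/- Let $\mathcal M=\{1,\dots,m\}$, let $\Theta$ be a convex, compact set of $m\times m$ positive-definite matrices, and let $A\subseteq\mathcal M$ be nonempty, $A^c=\mathcal M\setminus A$. Given $\theta=\tau\in\Theta$, the random vector $X_{\mathcal M}$ has the law $\mathcal N(0,\tau)$. Write $\Sigma_{A\tau}$ for the submatrix of $\tau$ with rows and columns in $A$, $\theta_1=\Sigma_{A\theta}$, $\Theta_1=\{\Sigma_{A\tau}:\tau\in\Theta\}$, and $\Lambda(\tau_1)=\{\tau\in\Theta:\Sigma_{A\tau}=\tau_1\}$ for $\tau_1\in\Theta_1$. Thus $X_A\sim\mathcal N(0,\tau_1)$ given $\theta_1=\tau_1$. All mutual informations are in bits. Fix $\tau_1\in\Theta_1$ and $\delta\in\mathbb R$. **Bayesian setting.** Let $\theta$ be a $\Theta$-valued random matrix with a known law, and fix a regular conditional law of $\theta$ given $\theta_1$ that is concentrated on $\Lambda(\tau_1')$ at each $\theta_1=\tau_1'\in\Theta_1$. Let $$\rho_A^{\mathcal B}(\delta,\tau_1)=\min I(X_A\wedge Y_{\mathcal M}\mid\theta_1=\tau_1)$$ over the joint laws of $(\theta,X_{\mathcal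 M},Y_{\mathcal M})$ (conditioned on $\theta_1=\tau_1$, with the given conditional law of $(\theta,X_{\mathcal M})$) such that $\theta,X_{\mathcal M} - \theta_1,X_A - Y_{\mathcal M}$ is a Markov chain, $\mu_{X_AY_{\mathcal M}|\theta_1=\tau_1}\ll\mu_{X_A|\theta_1=\tau_1}\times\mu_{Y_{\mathcal M}|\theta_1=\tau_1}$ and $\mathbb E[\|X_{\mathcal M}-Y_{\mathcal M}\|^2\mid\theta_1=\tau_1]\le\delta$. Let $$\Delta_{\min,A,\tau_1}=\mathbb E\Big[\min_{y\in\mathbb R^{A^c}}\mathbb E\big[\|X_{A^c}-y\|^2\,\big|\,X_A,\theta_1=\tau_1\big]\,\Big|\,\theta_1=\tau_1\Big],$$ $C=\mathbb E[X_AX_{A^c}^T\mid\theta_1=\tau_1]$, $G_{A,\tau_1}=I+\tau_1^{-1}CC^T\tau_1^{-1}$ and $d_{A\tau_1}(x_A,y_A)=(x_A-y_A)^TG_{A,\tau_1}(x_A-y_A)$. If $\delta>\Delta_{\min,A,\tau_1}$, then the minimum that defines $\rho_A^{\mathcal B}(\delta,\tau_1)$ is attained, and $$\rho_A^{\mathcal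 B}(\delta,\tau_1)=\min I(X_A\wedge Y_A\mid\theta_1=\tau_1),$$ where the minimum, also attained, is over the joint laws of $(X_A,Y_A)$ given $\theta_1=\tau_1$, with $X_A\sim\mathcal N(0,\tau_1)$, such that $\mu_{X_AY_A|\theta_1=\tau_1}\ll\mu_{X_A|\theta_1=\tau_1}\times\mu_{Y_A|\theta_1=\tau_1}$ and $\mathbb E[d_{A\tau_1}(X_A,Y_A)\mid\theta_1=\tau_1]\le\delta-\Delta_{\min,A,\tau_1}$. **nonBayesian setting.** Let $$\rho_A^{n\mathcal B}(\delta,\tau_1)=\inf I(X_A\wedge Y_{\mathcal M}\mid\theta_1=\tau_1)$$ over the conditional laws $\mu_{Y_{\mathcal M}|X_A,\theta_1=\tau_1}$, used as $\mu_{Y_{\mathcal M}|X_{\mathcal M},\theta=\tau}=\mu_{Y_{\mathcal M}|X_A,\theta_1=\tau_1}$ for all $\tau\in\Lambda(\tau_1)$, such that $\mu_{X_AY_{\mathcal M}|\theta_1=\tau_1}\ll\mu_{X_A|\theta_1=\tau_1}\times\mu_{Y_{\mathcal M}|\theta_1=\tau_1}$ and $\mathbb E[\|X_{\mathcal M}-Y_{\mathcal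 M}\|^2\mid\theta=\tau]\le\delta$ for all $\tau\in\Lambda(\tau_1)$. Now let $$\Delta_{\min,A,\tau_1}=\inf_{\mu_{Y_{A^c}|X_A,\theta_1=\tau_1}}\ \sup_{\tau\in\Lambda(\tau_1)}\ \sum_{i\in A^c}\mathbb E[(X_i-Y_i)^2\mid\theta=\tau].$$ If $\delta>\Delta_{\min,A,\tau_1}$, then $$\rho_A^{n\mathcal B}(\delta,\tau_1)=\inf I(X_A\wedge Y_A\mid\theta_1=\tau_1),$$ where the infimum is over the pairs of conditional laws $\mu_{Y_A|X_A,\theta_1=\tau_1}$, $\mu_{Y_{A^c}|Y_A,\theta_1=\tau_1}$, used as $\mu_{Y_{\mathcal M}|X_{\mathcal M},\theta=\tau}=\mu_{Y_A|X_A,\theta_1=\tau_1}\times\mu_{Y_{A^c}|Y_A,\theta_1=\tau_1}$ for all $\tau\in\Lambda(\tau_1)$, such that $\mu_{X_AY_A|\theta_1=\tau_1}\ll\mu_{X_A|\theta_1=\tau_1}\times\mu_{Y_A|\theta_1=\tau_1}$ and $\mathbb E[\|X_{\mathcal M}-Y_{\mathcal M}\|^2\mid\theta=\tau]\le\delta$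 for all $\tau\in\Lambda(\tau_1)$. -/

import Mathlib

open MeasureTheory ProbabilityTheory InformationTheory Matrix
open scoped ENNReal

noncomputable section

namespace USRD

/-! ### Measurable structure on matrices, Gaussian laws, mutual information -/

instance instMeasurableSpaceMatrix {ι ι' : Type*} : MeasurableSpace (Matrix ι ι' ℝ) :=
  inferInstanceAs (MeasurableSpace (ι → ι' → ℝ))

instance instBorelSpaceMatrix {ι ι' : Type*} [Countable ι] [Countable ι'] :
    BorelSpace (Matrix ι ι' ℝ) :=
  inferInstanceAs (BorelSpace (ι → ι' → ℝ))

lemma isClosed_posSemidef {ι : Type*} [Fintype ι] [DecidableEq ι] :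
    IsClosed {S : Matrix ι ι ℝ | S.PosSemidef} := by
  have h : {S : Matrix ι ι ℝ | S.PosSemidef} =
      {S | Sᴴ = S} ∩ ⋂ x : ι → ℝ, {S | 0 ≤ star x ⬝ᵥ (S *ᵥ x)} := by
    ext S
    simp only [Set.mem_ofPred_eq, Set.mem_inter_iff, Set.mem_iInter]
    rw [Matrix.posSemidef_iff_dotProduct_mulVec]
    rfl
  rw [h]
  refine IsClosed.inter ?_ (isClosed_iInter fun x => ?_)
  · exact isClosed_eq (by fun_prop) (by fun_prop)
  · exact isClosed_le (by fun_prop) (by fun_prop)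

lemma measurable_gaussian {ι : Type*} [Fintype ι] [DecidableEq ι] :
    Measurable fun S : Matrix ι ι ℝ => multivariateGaussian (0 : EuclideanSpace ℝ ι) S := by
  let PS : Set (Matrix ι ι ℝ) := {S | S.PosSemidef}
  have hPS : MeasurableSet PS := isClosed_posSemidef.measurableSet
  let g : PS → ProbabilityMeasure (EuclideanSpace ℝ ι) :=
    fun S => ⟨multivariateGaussian 0 S.1, inferInstance⟩
  have : FirstCountableTopology (Matrix ι ι ℝ) :=
    inferInstanceAs (FirstCountableTopology (ι → ι → ℝ))
  have hg : Continuous g := by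
    refine SeqContinuous.continuous fun u S hu => ?_
    refine ProbabilityMeasure.tendsto_of_tendsto_charFun fun t => ?_
    have e : ∀ T : PS, charFun (g T : Measure (EuclideanSpace ℝ ι)) t =
        Complex.exp (-(((t.ofLp ⬝ᵥ (T.1 *ᵥ t.ofLp) : ℝ) : ℂ)) / 2) := fun T => by
      change charFun (multivariateGaussian 0 T.1) t = _
      rw [charFun_multivariateGaussian T.2]
      congr 1
      simp
      ring
    have hc : Continuous fun T : PS =>
        Complex.exp (-(((t.ofLp ⬝ᵥ (T.1 *ᵥ t.ofLp) : ℝ) : ℂ)) / 2) := by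
      fun_prop
    rw [e S]
    exact ((hc.tendsto S).comp hu).congr fun n => (e (u n)).symm
  have hopen : ∀ G : Set (EuclideanSpace ℝ ι), IsOpen G →
      Measurable fun S : Matrix ι ι ℝ => multivariateGaussian (0 : EuclideanSpace ℝ ι) S G := by
    intro G hG
    refine measurable_of_restrict_of_restrict_compl hPS ?_ ?_
    · refine LowerSemicontinuous.measurable ?_
      rw [lowerSemicontinuous_iff_le_liminf]
      intro S
      exact ProbabilityMeasure.le_liminf_measure_open_of_tendsto (hg.tendsto S) hG
    · have : PSᶜ.domRestrict (fun S : Matrix ι ι ℝ =>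
          multivariateGaussian (0 : EuclideanSpace ℝ ι) S G) =
          fun _ => Measure.dirac (0 : EuclideanSpace ℝ ι) G := by
        ext S
        simp only [Set.domRestrict_apply]
        rw [multivariateGaussian_of_not_posSemidef _ S.2]
      rw [this]
      exact measurable_const
  exact Measurable.measure_of_isPiSystem_of_isProbabilityMeasure
    (BorelSpace.measurable_eq (α := EuclideanSpace ℝ ι)) isPiSystem_isOpen hopen

/-- The family `S ↦ N(0, S)` of centred Gaussian laws, as a Markov kernel. -/
def gaussianKernel (ι : Type*) [Fintype ι] [DecidableEq ι] :
    Kernel (Matrix ι ι ℝ) (EuclideanSpace ℝ ι) where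
  toFun S := multivariateGaussian 0 S
  measurable' := measurable_gaussian

instance {ι : Type*} [Fintype ι] [DecidableEq ι] : IsMarkovKernel (gaussianKernel ι) :=
  ⟨fun S => inferInstanceAs (IsProbabilityMeasure (multivariateGaussian 0 S))⟩

/-- Mutual information `I(U ∧ V)`, in bits, of two random variables under `P`. -/
def mutualInfo {Ω E F : Type*} [MeasurableSpace Ω] [MeasurableSpace E] [MeasurableSpace F]
    (P : Measure Ω) (U : Ω → E) (V : Ω → F) : ℝ≥0∞ :=
  klDiv (P.map fun ω => (U ω, V ω)) ((P.map U).prod (P.map V)) / ENNReal.ofReal (Real.log 2)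

/-- The joint law of `(U, V)` is absolutely continuous with respect to the product of the
marginal laws. -/
def JointAC {Ω E F : Type*} [MeasurableSpace Ω] [MeasurableSpace E] [MeasurableSpace F]
    (P : Measure Ω) (U : Ω → E) (V : Ω → F) : Prop :=
  (P.map fun ω => (U ω, V ω)) ≪ (P.map U).prod (P.map V)

/-- `U -∘- V -∘- W` is a Markov chain under `P`: some conditional law of `W` given `(U, V)`
depends on `V` alone. -/
def IsMarkovChain {Ω E F G : Type*} [MeasurableSpace Ω] [MeasurableSpace E] [MeasurableSpace F]
    [MeasurableSpace G] (P : Measure Ω) (U : Ω → E) (V : Ω → F) (W : Ω → G) : Prop :=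
  ∃ K : Kernel F G, IsMarkovKernel K ∧
    (P.map fun ω => ((U ω, V ω), W ω)) =
      (P.map fun ω => (U ω, V ω)) ⊗ₘ K.comap Prod.snd measurable_snd

/-! ### Sampled and unsampled components -/

variable {m : ℕ}

/-- `x_B`, the components of `x` with index in `B`. -/
def restr (B : Finset (Fin m)) (x : EuclideanSpace ℝ (Fin m)) : EuclideanSpace ℝ B :=
  WithLp.toLp 2 fun i => x i

lemma measurable_restr (B : Finset (Fin m)) : Measurable (restr B) := by
  unfold restr
  fun_prop

/-- The vector of `ℝ^m` with sampled components `p.1` and unsampled components `p.2`. -/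
def glue (A : Finset (Fin m)) (p : EuclideanSpace ℝ A × EuclideanSpace ℝ ↥(Aᶜ)) :
    EuclideanSpace ℝ (Fin m) :=
  WithLp.toLp 2 fun i =>
    if h : i ∈ A then p.1 ⟨i, h⟩ else p.2 ⟨i, Finset.mem_compl.mpr h⟩

lemma measurable_glue (A : Finset (Fin m)) : Measurable (glue A) := by
  unfold glue
  refine (WithLp.measurable_toLp 2 _).comp (measurable_pi_lambda _ fun i => ?_)
  by_cases h : i ∈ A
  · simp only [h, dif_pos]; fun_prop
  · simp only [h, dif_neg, not_false_eq_true]; fun_prop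

/-- `Σ_A`, the covariance matrix of the sampled components. -/
def subCov (A : Finset (Fin m)) (τ : Matrix (Fin m) (Fin m) ℝ) : Matrix A A ℝ :=
  τ.submatrix (fun i => (i : Fin m)) fun i => (i : Fin m)

/-- `Θ₁ = {Σ_{A τ} : τ ∈ Θ}`. -/
def Theta1 (A : Finset (Fin m)) (Θ : Set (Matrix (Fin m) (Fin m) ℝ)) : Set (Matrix A A ℝ) :=
  subCov A '' Θ

/-- The ambiguity atom `Λ(τ₁)`. -/
def atom (A : Finset (Fin m)) (Θ : Set (Matrix (Fin m) (Fin m) ℝ)) (τ₁ : Matrix A A ℝ) :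
    Set (Matrix (Fin m) (Fin m) ℝ) :=
  {τ ∈ Θ | subCov A τ = τ₁}

/-! ### Bayesian setting

Below, `π` stands for the conditional law of `θ` given `θ₁ = τ₁`. -/

/-- `κ` is a version of the regular conditional law of `θ` given `θ₁ = Σ_{A θ}`, when `θ` has
law `μ`; the version is chosen so that `κ τ₁` lives on `Λ(τ₁)` for each `τ₁ ∈ Θ₁`. -/
def IsCondLaw (A : Finset (Fin m)) (Θ : Set (Matrix (Fin m) (Fin m) ℝ))
    (μ : Measure (Matrix (Fin m) (Fin m) ℝ))
    (κ : Kernel (Matrix A A ℝ) (Matrix (Fin m) (Fin m) ℝ)) : Prop :=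
  (μ.map (subCov A)) ⊗ₘ κ = μ.map (fun τ => (subCov A τ, τ)) ∧
    ∀ τ₁ ∈ Theta1 A Θ, ∀ᵐ τ ∂(κ τ₁), τ ∈ atom A Θ τ₁

/-- The conditional law of `X_M` given `θ₁ = τ₁`. -/
def condLawX (π : Measure (Matrix (Fin m) (Fin m) ℝ)) : Measure (EuclideanSpace ℝ (Fin m)) :=
  (π ⊗ₘ gaussianKernel (Fin m)).map Prod.snd

instance (π : Measure (Matrix (Fin m) (Fin m) ℝ)) [IsProbabilityMeasure π] :
    IsProbabilityMeasure (condLawX π) :=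
  Measure.isProbabilityMeasure_map measurable_snd.aemeasurable

/-- The constraint set `κ_A^B(δ, τ₁)`. Its elements are given through the conditional law `P` of
`(θ, X_M, Y_M)` given `θ₁ = τ₁`. -/
def bayesFeasible (A : Finset (Fin m)) (π : Measure (Matrix (Fin m) (Fin m) ℝ)) (δ : ℝ) :
    Set (Measure (Matrix (Fin m) (Fin m) ℝ ×
      EuclideanSpace ℝ (Fin m) × EuclideanSpace ℝ (Fin m))) :=
  {P | P.map (fun ω => (ω.1, ω.2.1)) = π ⊗ₘ gaussianKernel (Fin m) ∧
    IsMarkovChain P (fun ω => (ω.1, ω.2.1)) (fun ω => (subCov A ω.1, restr A ω.2.1))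
      (fun ω => ω.2.2) ∧
    JointAC P (fun ω => restr A ω.2.1) (fun ω => ω.2.2) ∧
    ∫⁻ ω, ENNReal.ofReal (‖ω.2.1 - ω.2.2‖ ^ 2) ∂P ≤ ENNReal.ofReal δ}

/-- The objective `I(X_A ∧ Y_M | θ₁ = τ₁)`. -/
def bayesInfo (A : Finset (Fin m)) (P : Measure (Matrix (Fin m) (Fin m) ℝ ×
    EuclideanSpace ℝ (Fin m) × EuclideanSpace ℝ (Fin m))) : ℝ≥0∞ :=
  mutualInfo P (fun ω => restr A ω.2.1) (fun ω => ω.2.2)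

/-- `ρ_A^B(δ, τ₁)`. -/
def rhoBayes (A : Finset (Fin m)) (π : Measure (Matrix (Fin m) (Fin m) ℝ)) (δ : ℝ) : ℝ≥0∞ :=
  ⨅ P ∈ bayesFeasible A π δ, bayesInfo A P

/-- Bayesian `Δ_{min,A,τ₁}`: the mean over `X_A` of the least conditional mean-squared error, given
`X_A` and `θ₁ = τ₁`, with which a vector `y` can represent `X_{A^c}`. -/
def deltaMinBayes (A : Finset (Fin m)) (π : Measure (Matrix (Fin m) (Fin m) ℝ))
    [IsProbabilityMeasure π] : ℝ≥0∞ :=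
  ∫⁻ xA, ⨅ y : EuclideanSpace ℝ ↥(Aᶜ),
      ∫⁻ z, ENNReal.ofReal (‖z - y‖ ^ 2) ∂(condDistrib (restr Aᶜ) (restr A) (condLawX π) xA)
    ∂((condLawX π).map (restr A))

/-- `E[X_A X_{A^c}^T | θ₁ = τ₁]`. -/
def crossCov (A : Finset (Fin m)) (π : Measure (Matrix (Fin m) (Fin m) ℝ)) :
    Matrix A ↥(Aᶜ) ℝ :=
  Matrix.of fun i j => ∫ x, x (i : Fin m) * x (j : Fin m) ∂(condLawX π)

/-- The weight matrix `G_{A,τ₁}`. -/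
def weightMatrix (A : Finset (Fin m)) (π : Measure (Matrix (Fin m) (Fin m) ℝ))
    (τ₁ : Matrix A A ℝ) : Matrix A A ℝ :=
  1 + τ₁⁻¹ * crossCov A π * (crossCov A π)ᵀ * τ₁⁻¹

/-- The weighted distortion measure `d_{A τ₁}`. -/
def weightedDist (A : Finset (Fin m)) (π : Measure (Matrix (Fin m) (Fin m) ℝ))
    (τ₁ : Matrix A A ℝ) (x y : EuclideanSpace ℝ A) : ℝ :=
  (x - y).ofLp ⬝ᵥ (weightMatrix A π τ₁ *ᵥ (x - y).ofLp)

/-- Constraint set of the reduced Bayesian problem: conditional laws of `(X_A, Y_A)` given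
`θ₁ = τ₁`. -/
def bayesReduced (A : Finset (Fin m)) (π : Measure (Matrix (Fin m) (Fin m) ℝ)) [IsProbabilityMeasure π]
    (τ₁ : Matrix A A ℝ) (δ : ℝ) : Set (Measure (EuclideanSpace ℝ A × EuclideanSpace ℝ A)) :=
  {Q | Q.map Prod.fst = multivariateGaussian 0 τ₁ ∧
    JointAC Q Prod.fst Prod.snd ∧
    ∫⁻ p, ENNReal.ofReal (weightedDist A π τ₁ p.1 p.2) ∂Q
      ≤ ENNReal.ofReal δ - deltaMinBayes A π}

/-! ### nonBayesian setting -/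

/-- The law of `(X_M, Y_M)` given `θ = τ`, when the conditional law of `Y_M` given `X_M` is
`W` evaluated at `X_A`. -/
def jointLaw (A : Finset (Fin m)) {E : Type*} [MeasurableSpace E]
    (W : Kernel (EuclideanSpace ℝ A) E) (τ : Matrix (Fin m) (Fin m) ℝ) :
    Measure (EuclideanSpace ℝ (Fin m) × E) :=
  multivariateGaussian 0 τ ⊗ₘ W.comap (restr A) (measurable_restr A)

/-- The constraint set `κ_A^{nB}(δ, τ₁)`, parametrized by the common conditional law
`W = μ_{Y_M | X_A, θ₁ = τ₁}`. -/
def nonBayesFeasible (A : Finset (Fin m)) (Θ : Set (Matrix (Fin m) (Fin m) ℝ))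
    (τ₁ : Matrix A A ℝ) (δ : ℝ) :
    Set (Kernel (EuclideanSpace ℝ A) (EuclideanSpace ℝ (Fin m))) :=
  {W | IsMarkovKernel W ∧
    JointAC (multivariateGaussian 0 τ₁ ⊗ₘ W) Prod.fst Prod.snd ∧
    ∀ τ ∈ atom A Θ τ₁,
      ∫⁻ p, ENNReal.ofReal (‖p.1 - p.2‖ ^ 2) ∂(jointLaw A W τ) ≤ ENNReal.ofReal δ}

/-- `ρ_A^{nB}(δ, τ₁)`, the infimum of `I(X_A ∧ Y_M | θ₁ = τ₁)`. -/
def rhoNonBayes (A : Finset (Fin m)) (Θ : Set (Matrix (Fin m) (Fin m) ℝ))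
    (τ₁ : Matrix A A ℝ) (δ : ℝ) : ℝ≥0∞ :=
  ⨅ W ∈ nonBayesFeasible A Θ τ₁ δ,
    mutualInfo (multivariateGaussian 0 τ₁ ⊗ₘ W) Prod.fst Prod.snd

/-- nonBayesian `Δ_{min,A,τ₁}`. -/
def deltaMinNonBayes (A : Finset (Fin m)) (Θ : Set (Matrix (Fin m) (Fin m) ℝ))
    (τ₁ : Matrix A A ℝ) : ℝ≥0∞ :=
  ⨅ (V : Kernel (EuclideanSpace ℝ A) (EuclideanSpace ℝ ↥(Aᶜ))) (_ : IsMarkovKernel V),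
    ⨆ τ ∈ atom A Θ τ₁,
      ∫⁻ p, ENNReal.ofReal (‖restr Aᶜ p.1 - p.2‖ ^ 2) ∂(jointLaw A V τ)

/-- The channel from `X_A` to `Y_M` that draws `Y_A` from `X_A` through `W` and then `Y_{A^c}` from
`Y_A` through `V`. -/
def cascade (A : Finset (Fin m)) (W : Kernel (EuclideanSpace ℝ A) (EuclideanSpace ℝ A))
    (V : Kernel (EuclideanSpace ℝ A) (EuclideanSpace ℝ ↥(Aᶜ))) :
    Kernel (EuclideanSpace ℝ A) (EuclideanSpace ℝ (Fin m)) :=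
  (W ⊗ₖ Kernel.prodMkLeft (EuclideanSpace ℝ A) V).map (glue A)

/-- Constraint set of the reduced nonBayesian problem: pairs
`(μ_{Y_A | X_A, θ₁ = τ₁}, μ_{Y_{A^c} | Y_A, θ₁ = τ₁})`. -/
def nonBayesReduced (A : Finset (Fin m)) (Θ : Set (Matrix (Fin m) (Fin m) ℝ))
    (τ₁ : Matrix A A ℝ) (δ : ℝ) :
    Set (Kernel (EuclideanSpace ℝ A) (EuclideanSpace ℝ A) ×
      Kernel (EuclideanSpace ℝ A) (EuclideanSpace ℝ ↥(Aᶜ))) :=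
  {c | IsMarkovKernel c.1 ∧ IsMarkovKernel c.2 ∧
    JointAC (multivariateGaussian 0 τ₁ ⊗ₘ c.1) Prod.fst Prod.snd ∧
    ∀ τ ∈ atom A Θ τ₁,
      ∫⁻ p, ENNReal.ofReal (‖p.1 - p.2‖ ^ 2) ∂(jointLaw A (cascade A c.1 c.2) τ)
        ≤ ENNReal.ofReal δ}

end USRD

end

-- Bayesian setting. Given `θ₁ = τ₁`, the law of `X_M` is a mixture of centred Gaussians that share
-- the marginal `N(0, τ₁)` on `A`. Each component has linear regression of `X_{A^c}` on `X_A` with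
-- coefficients `τ₁⁻¹` times its cross-covariance, so the mixture, although it need not be Gaussian,
-- also has a linear conditional mean `L X_A` (`setIntegral_condLawX`, `condDistrib_condLawX_mean`).
-- Since `Y_M` depends on `X_M` only through `X_A`, the bias-variance identity turns the distortion
-- into `E(‖X_A - Y_A‖² + ‖L X_A - Y_{A^c}‖²) + Δ_min` (`lintegral_distortion_eq`). The point `(X_A,
-- L X_A)` lies on the graph of `L`; projecting `Y_M` orthogonally onto that graph increases neither
-- the distortion (`exists_graph_projection`) nor, by data processing, the information. On the graph
-- the distortion is the weighted one, `d_A`.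
--
-- The minimum is attained because the divergence is a supremum of weakly continuous functionals,
-- hence lower semicontinuous, and the admissible joint laws form a weakly compact set
-- (`exists_min_klDiv`).
--
-- nonBayesian setting. A cascade is a feasible channel and carries no more information than its
-- first stage (`mutualInfo_cascade_le`). Conversely, a feasible channel of finite information is
-- mixed, with small weight, with a finitely valued estimate whose distortion is below `δ` uniformly
-- over the atom. Convexity bounds the information of the mixture, and its distortion is strictly
-- below `δ`. That slack pays for hiding `Y_{A^c}` in the fractional part of one rescaled coordinate
-- of `Y_A` (`exists_encoding`): then `Y_{A^c}` is a function of the new `Y_A`, which is itself a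
-- function of the old `Y_M`. The weight then tends to 0.

noncomputable section

namespace USRD

open Filter Topology
open scoped BoundedContinuousFunction NNReal

/-! ### Variational formula for the Kullback-Leibler divergence -/

section Variational

variable {α : Type*} [MeasurableSpace α]

/-- The affine functional of `(Q, S)` whose supremum over `f` is `klDiv Q S`. -/
def dualKL (Q S : Measure α) (f : α → ℝ) : ℝ := ∫ x, f x ∂Q - ∫ x, (Real.exp (f x) - 1) ∂S

/-- Young's inequality for the conjugate pair `klFun` and `exp - 1`: for `r > 0` it is `1 + u ≤ exp
u` at `u = a - log r`. -/
lemma mul_sub_exp_add_one_le_klFun {r : ℝ} (hr : 0 ≤ r) (a : ℝ) :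
    r * a - Real.exp a + 1 ≤ klFun r := by
  rw [klFun_apply]
  rcases hr.eq_or_lt with rfl | hr
  · simp [Real.exp_nonneg]
  · have h := Real.add_one_le_exp (a - Real.log r)
    rw [Real.exp_sub, Real.exp_log hr, le_div_iff₀ hr] at h
    nlinarith

lemma integrable_of_abs_le {μ : Measure α} [IsFiniteMeasure μ] {f : α → ℝ} (hf : Measurable f)
    {M : ℝ} (hM : ∀ x, |f x| ≤ M) : Integrable f μ :=
  Integrable.of_bound hf.aestronglyMeasurable M (ae_of_all _ fun x => by simpa using hM x)

lemma integrable_exp_sub_one {μ : Measure α} [IsFiniteMeasure μ] {f : α → ℝ} (hf : Measurable f)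
    {M : ℝ} (hM : ∀ x, |f x| ≤ M) : Integrable (fun x => Real.exp (f x) - 1) μ := by
  refine integrable_of_abs_le (M := Real.exp M + 1) (by fun_prop) fun x => ?_
  have h1 : Real.exp (f x) ≤ Real.exp M := Real.exp_le_exp.2 (abs_le.1 (hM x)).2
  have h2 := Real.exp_pos (f x)
  rw [abs_le]
  constructor <;> linarith

variable {Q S : Measure α} [IsFiniteMeasure Q] [IsFiniteMeasure S]

/-- Writing both integrals against `S` makes the dual functional comparable with `klFun` of the
density pointwise. -/
lemma dualKL_eq_integral (hQS : Q ≪ S) {f : α → ℝ} (hf : Measurable f) {M : ℝ}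
    (hM : ∀ x, |f x| ≤ M) :
    Integrable (fun x => (Q.rnDeriv S x).toReal * f x - Real.exp (f x) + 1) S ∧
    dualKL Q S f = ∫ x, ((Q.rnDeriv S x).toReal * f x - Real.exp (f x) + 1) ∂S := by
  have h1 : Integrable (fun x => (Q.rnDeriv S x).toReal * f x) S :=
    (integrable_toReal_rnDeriv_mul_iff hQS).2 (integrable_of_abs_le hf hM)
  have h2 := integrable_exp_sub_one (μ := S) hf hM
  have e : (fun x => (Q.rnDeriv S x).toReal * f x - Real.exp (f x) + 1) =
      fun x => (Q.rnDeriv S x).toReal * f x - (Real.exp (f x) - 1) := by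
    funext x; ring
  rw [e]
  refine ⟨h1.sub h2, ?_⟩
  rw [integral_sub h1 h2, dualKL, ← integral_rnDeriv_smul hQS]
  simp

/-- The easy half of the variational formula. -/
lemma dualKL_le_klDiv {f : α → ℝ} (hf : Measurable f) {M : ℝ} (hM : ∀ x, |f x| ≤ M) :
    ENNReal.ofReal (dualKL Q S f) ≤ klDiv Q S := by
  by_cases h : Q ≪ S ∧ Integrable (llr Q S) Q
  · rw [klDiv_eq_integral_klFun, if_pos h]
    obtain ⟨hi, he⟩ := dualKL_eq_integral h.1 hf hM
    rw [he]
    exact ENNReal.ofReal_le_ofReal (integral_mono hi ((integrable_klFun_rnDeriv_iff h.1).2 h.2)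
      fun x => mul_sub_exp_add_one_le_klFun ENNReal.toReal_nonneg _)
  · rw [klDiv_eq_integral_klFun, if_neg h]
    exact le_top

/-- With `g` the clamped value, the expression is `klFun g + (r - g) * log g`. Clamping to an
interval around 1 gives `r - g` and `log g` the same sign. Nonnegativity is what Fatou's lemma needs
below. -/
lemma clamp_aux_nonneg (r : ℝ) {n : ℝ} (hn : 1 ≤ n) :
    0 ≤ r * Real.log (max n⁻¹ (min r n)) - max n⁻¹ (min r n) + 1 := by
  have hn0 : 0 < n := by linarith
  have hi : n⁻¹ ≤ 1 := inv_le_one_of_one_le₀ hn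
  have hi0 : 0 < n⁻¹ := by positivity
  have key : ∀ g : ℝ, 0 < g → 0 ≤ (r - g) * Real.log g → 0 ≤ r * Real.log g - g + 1 := by
    intro g hg h
    have := klFun_nonneg hg.le
    rw [klFun_apply] at this
    nlinarith
  refine key _ (lt_max_of_lt_left hi0) ?_
  rcases le_total r n⁻¹ with h1 | h1
  · have : max n⁻¹ (min r n) = n⁻¹ := max_eq_left ((min_le_left _ _).trans h1)
    rw [this]
    exact mul_nonneg_of_nonpos_of_nonpos (by linarith) (Real.log_nonpos hi0.le hi)
  rcases le_total r n with h2 | h2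
  · rw [min_eq_left h2, max_eq_right h1]; simp
  · rw [min_eq_right h2, max_eq_right (hi.trans hn)]
    exact mul_nonneg (by linarith) (Real.log_nonneg hn)

lemma clamp_aux_tendsto {r : ℝ} (hr : 0 ≤ r) :
    Tendsto (fun n : ℕ => r * Real.log (max ((n : ℝ) + 1)⁻¹ (min r (n + 1)))
      - max ((n : ℝ) + 1)⁻¹ (min r (n + 1)) + 1) atTop (𝓝 (klFun r)) := by
  have hinf : Tendsto (fun n : ℕ => (n : ℝ) + 1) atTop atTop :=
    tendsto_atTop_add_const_right _ _ tendsto_natCast_atTop_atTop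
  have hinv : Tendsto (fun n : ℕ => ((n : ℝ) + 1)⁻¹) atTop (𝓝 0) :=
    tendsto_inv_atTop_zero.comp hinf
  rcases hr.eq_or_lt with rfl | hr
  · have e : ∀ n : ℕ, max ((n : ℝ) + 1)⁻¹ (min 0 (n + 1)) = ((n : ℝ) + 1)⁻¹ := fun n => by
      rw [min_eq_left (by positivity), max_eq_left (by positivity)]
    simp only [e, zero_mul, zero_sub, klFun_zero]
    simpa using hinv.neg.add_const 1
  · refine tendsto_const_nhds.congr' ?_
    filter_upwards [hinf.eventually_ge_atTop r, hinv.eventually (gt_mem_nhds hr)] with n h1 h2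
    rw [min_eq_left h1, max_eq_right h2.le, klFun_apply]
    ring

/-- The hard half of the variational formula, over bounded measurable functions. -/
lemma klDiv_le_of_dualKL_le {c : ℝ}
    (h : ∀ f : α → ℝ, Measurable f → (∃ M, ∀ x, |f x| ≤ M) → dualKL Q S f ≤ c) :
    klDiv Q S ≤ ENNReal.ofReal c := by
  -- If `S s = 0 < Q s`, the function equal to `M` on `s` and 0 elsewhere has dual value `M * Q.real
  -- s`, unbounded in `M`.
  have hac : Q ≪ S := by
    refine Measure.AbsolutelyContinuous.mk fun s hs hSs => ?_
    by_contra hQ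
    have hpos : 0 < Q.real s := ENNReal.toReal_pos hQ (measure_ne_top _ _)
    have hb : ∀ M : ℝ, M * Q.real s ≤ c := by
      intro M
      refine le_trans (le_of_eq ?_) (h (s.indicator fun _ => M) (measurable_const.indicator hs)
        ⟨|M|, fun x => by by_cases hx : x ∈ s <;> simp [hx]⟩)
      rw [dualKL, integral_indicator_const _ hs]
      have : ∫ x, (Real.exp (s.indicator (fun _ => M) x) - 1) ∂S = 0 := by
        refine integral_eq_zero_of_ae ?_
        have : ∀ᵐ x ∂S, x ∉ s := measure_eq_zero_iff_ae_notMem.1 hSs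
        filter_upwards [this] with x hx
        simp [hx]
      rw [this]; simp [mul_comm]
    have := hb ((c + 1) / Q.real s)
    rw [div_mul_cancel₀ _ hpos.ne'] at this
    linarith
  rw [klDiv_eq_lintegral_klFun_of_ac hac]
  set r : α → ℝ := fun x => (Q.rnDeriv S x).toReal with hr
  have hrm : Measurable r := by fun_prop
  have hr0 : ∀ x, 0 ≤ r x := fun x => ENNReal.toReal_nonneg
  -- The optimal `f` is the log density, possibly unbounded. The density is clamped to `[1/(n+1),
  -- n+1]`, and Fatou's lemma passes to the limit.
  let g : ℕ → α → ℝ := fun n x => max ((n : ℝ) + 1)⁻¹ (min (r x) (n + 1))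
  have hgm : ∀ n, Measurable (g n) := fun n => by fun_prop
  have hg1 : ∀ (n : ℕ) x, ((n : ℝ) + 1)⁻¹ ≤ g n x := fun n x => le_max_left _ _
  have hn1 : ∀ n : ℕ, (1 : ℝ) ≤ n + 1 := fun n => by simp
  have hg2 : ∀ (n : ℕ) x, g n x ≤ n + 1 := fun n x =>
    max_le ((inv_le_one_of_one_le₀ (hn1 n)).trans (hn1 n)) (min_le_right _ _)
  have hg0 : ∀ (n : ℕ) x, 0 < g n x := fun n x => lt_of_lt_of_le (by positivity) (hg1 n x)
  have hbd : ∀ (n : ℕ) x, |Real.log (g n x)| ≤ Real.log (n + 1) := fun n x => by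
    rw [abs_le]
    constructor
    · rw [← Real.log_inv]; exact Real.log_le_log (by positivity) (hg1 n x)
    · exact Real.log_le_log (hg0 n x) (hg2 n x)
  have hlim : ∀ x, Tendsto (fun n : ℕ => ENNReal.ofReal
      (r x * Real.log (g n x) - g n x + 1)) atTop (𝓝 (ENNReal.ofReal (klFun (r x)))) := fun x =>
    (ENNReal.continuous_ofReal.tendsto _).comp (clamp_aux_tendsto (hr0 x))
  calc ∫⁻ x, ENNReal.ofReal (klFun (r x)) ∂S
      = ∫⁻ x, liminf (fun n : ℕ => ENNReal.ofReal
          (r x * Real.log (g n x) - g n x + 1)) atTop ∂S :=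
        lintegral_congr fun x => (hlim x).liminf_eq.symm
    _ ≤ liminf (fun n : ℕ => ∫⁻ x, ENNReal.ofReal
          (r x * Real.log (g n x) - g n x + 1) ∂S) atTop :=
        lintegral_liminf_le fun n => by
          have := hgm n
          fun_prop
    _ ≤ ENNReal.ofReal c := by
        refine liminf_le_of_le (by isBoundedDefault) fun b hb => ?_
        obtain ⟨n, hn⟩ := hb.exists
        refine hn.trans ?_
        have hm : Measurable fun x => Real.log (g n x) := (hgm n).log
        obtain ⟨hi, he⟩ := dualKL_eq_integral hac hm (hbd n)
        have := h _ hm ⟨_, hbd n⟩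
        simp only [Real.exp_log (hg0 n _)] at hi he
        rw [← ofReal_integral_eq_lintegral_ofReal hi
          (ae_of_all _ fun x => clamp_aux_nonneg (r x) (hn1 n)), ← he]
        exact ENNReal.ofReal_le_ofReal this

/-- The hard half of the variational formula, over bounded continuous functions. -/
lemma klDiv_le_of_dualKL_boundedContinuous_le {α : Type*} [MeasurableSpace α] [TopologicalSpace α]
    [TopologicalSpace.PseudoMetrizableSpace α] [BorelSpace α] {Q S : Measure α} [IsFiniteMeasure Q]
    [IsFiniteMeasure S] {c : ℝ} (h : ∀ f : α →ᵇ ℝ, dualKL Q S f ≤ c) :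
    klDiv Q S ≤ ENNReal.ofReal c := by
  let _ := TopologicalSpace.pseudoMetrizableSpacePseudoMetric α
  refine klDiv_le_of_dualKL_le fun f hf ⟨M, hM⟩ => ?_
  rcases isEmpty_or_nonempty α with he | ⟨⟨x₀⟩⟩
  · have := h 0
    rw [Measure.eq_zero_of_isEmpty Q, Measure.eq_zero_of_isEmpty S] at *
    simpa [dualKL] using this
  have hM0 : 0 ≤ M := (abs_nonneg _).trans (hM x₀)
  refine le_of_forall_pos_le_add fun ε hε => ?_
  have hL : 0 < 1 + Real.exp M := by positivity
  -- Approximation in `L¹(Q + S)` controls both integrals at once. After clamping to `[-M, M]`,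
  -- where `exp` is Lipschitz with constant `exp M`, the dual value moves by at most `1 + exp M`
  -- times the `L¹` distance.
  obtain ⟨g, hg, -⟩ := (integrable_of_abs_le (μ := Q + S) hf hM).exists_boundedContinuous_integral_sub_le
    (div_pos hε hL)
  let k : α → ℝ := fun x => max (-M) (min (g x) M)
  have hkc : Continuous k := by fun_prop
  have hkM : ∀ x, |k x| ≤ M := fun x =>
    abs_le.2 ⟨le_max_left _ _, max_le (by linarith) (min_le_right _ _)⟩
  let K : α →ᵇ ℝ := BoundedContinuousFunction.ofNormedAddCommGroup k hkc M (by simpa using hkM)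
  have hK : ⇑K = k := rfl
  have hkf : ∀ x, |f x - k x| ≤ ‖f x - g x‖ := by
    intro x
    have hf1 := abs_le.1 (hM x)
    have e : f x = max (-M) (min (f x) M) := by
      rw [min_eq_left hf1.2, max_eq_right hf1.1]
    calc |f x - k x| = |max (-M) (min (f x) M) - max (-M) (min (g x) M)| := by rw [← e]
      _ ≤ |min (f x) M - min (g x) M| := by
        simpa using abs_max_sub_max_le_max (-M) (min (f x) M) (-M) (min (g x) M)
      _ ≤ |f x - g x| := by
        simpa using abs_min_sub_min_le_max (f x) M (g x) M
      _ = ‖f x - g x‖ := rfl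
  have hexp : ∀ x, |Real.exp (k x) - Real.exp (f x)| ≤ Real.exp M * |f x - k x| := by
    have key : ∀ a b : ℝ, a ≤ M → b ≤ M → Real.exp a - Real.exp b ≤ Real.exp M * |b - a| := by
      intro a b ha hb
      have h1 : Real.exp a * (1 + (b - a)) ≤ Real.exp b := by
        have := Real.add_one_le_exp (b - a)
        calc _ ≤ Real.exp a * Real.exp (b - a) := by
              gcongr; linarith
          _ = Real.exp b := by rw [← Real.exp_add]; congr 1; ring
      have h2 : Real.exp a ≤ Real.exp M := Real.exp_le_exp.2 ha
      have h3 : -(b - a) ≤ |b - a| := neg_le_abs _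
      calc Real.exp a - Real.exp b ≤ Real.exp a * (-(b - a)) := by linarith
        _ ≤ Real.exp a * |b - a| := by gcongr
        _ ≤ _ := by gcongr
    intro x
    have h1 := abs_le.1 (hM x)
    have h2 := abs_le.1 (hkM x)
    rw [abs_le]
    constructor
    · have := key (f x) (k x) h1.2 h2.2
      rw [abs_sub_comm] at this
      linarith
    · exact key _ _ h2.2 h1.2
  have hkm := hkc.measurable
  have hid : ∀ μ : Measure α, IsFiniteMeasure μ → Integrable (fun x => |f x - k x|) μ := fun μ _ =>
    ((integrable_of_abs_le hf hM).sub (integrable_of_abs_le hkm hkM)).abs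
  have hsum : ∫ x, |f x - k x| ∂Q + ∫ x, |f x - k x| ∂S ≤ ε / (1 + Real.exp M) := by
    rw [← integral_add_measure (hid Q inferInstance) (hid S inferInstance)]
    refine (integral_mono (hid _ inferInstance) ?_ hkf).trans hg
    exact ((integrable_of_abs_le hf hM).sub (g.integrable _)).norm
  have hQ0 : 0 ≤ ∫ x, |f x - k x| ∂Q := integral_nonneg fun x => abs_nonneg _
  have hS0 : 0 ≤ ∫ x, |f x - k x| ∂S := integral_nonneg fun x => abs_nonneg _
  have h1 : ∫ x, f x ∂Q - ∫ x, k x ∂Q ≤ ∫ x, |f x - k x| ∂Q := by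
    rw [← integral_sub (integrable_of_abs_le hf hM) (integrable_of_abs_le hkm hkM)]
    exact integral_mono ((integrable_of_abs_le hf hM).sub (integrable_of_abs_le hkm hkM))
      (hid Q inferInstance) fun x => le_abs_self _
  have h2 : ∫ x, (Real.exp (k x) - 1) ∂S - ∫ x, (Real.exp (f x) - 1) ∂S
      ≤ Real.exp M * ∫ x, |f x - k x| ∂S := by
    rw [← integral_sub (integrable_exp_sub_one hkm hkM) (integrable_exp_sub_one hf hM),
      ← integral_const_mul]
    refine integral_mono ((integrable_exp_sub_one hkm hkM).sub (integrable_exp_sub_one hf hM))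
      ((hid S inferInstance).const_mul _) fun x => ?_
    have := (abs_le.1 (hexp x)).2
    simp only
    linarith
  have h3 := h K
  rw [hK] at h3
  rw [le_div_iff₀ hL] at hsum
  have he : 0 < Real.exp M := Real.exp_pos M
  have : dualKL Q S f - dualKL Q S k ≤ ε := by
    simp only [dualKL]
    nlinarith
  linarith

end Variational

-- Convexity, finiteness and lower semicontinuity of the divergence

section Consequences

lemma integral_smul_add_smul {α : Type*} [MeasurableSpace α] {μ ν : Measure α} {f : α → ℝ}
    (a b : ℝ≥0) (hμ : Integrable f μ) (hν : Integrable f ν) :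
    ∫ x, f x ∂(a • μ + b • ν) = a * ∫ x, f x ∂μ + b * ∫ x, f x ∂ν := by
  rw [integral_add_measure (hμ.smul_measure_nnreal) (hν.smul_measure_nnreal),
    integral_smul_nnreal_measure, integral_smul_nnreal_measure]
  simp [NNReal.smul_def]

lemma dualKL_smul_add_smul {α : Type*} [MeasurableSpace α] {Q₁ Q₂ S₁ S₂ : Measure α}
    [IsFiniteMeasure Q₁] [IsFiniteMeasure Q₂] [IsFiniteMeasure S₁] [IsFiniteMeasure S₂]
    (a b : ℝ≥0) {f : α → ℝ} (hf : Measurable f) {M : ℝ} (hM : ∀ x, |f x| ≤ M) :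
    dualKL (a • Q₁ + b • Q₂) (a • S₁ + b • S₂) f = a * dualKL Q₁ S₁ f + b * dualKL Q₂ S₂ f := by
  simp only [dualKL]
  rw [integral_smul_add_smul a b (integrable_of_abs_le hf hM) (integrable_of_abs_le hf hM),
    integral_smul_add_smul a b (integrable_exp_sub_one hf hM) (integrable_exp_sub_one hf hM)]
  ring

/-- Joint convexity of the Kullback-Leibler divergence. -/
lemma klDiv_convex {α : Type*} [MeasurableSpace α] {Q₁ Q₂ S₁ S₂ : Measure α} [IsFiniteMeasure Q₁]
    [IsFiniteMeasure Q₂] [IsFiniteMeasure S₁] [IsFiniteMeasure S₂] (a b : ℝ≥0) :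
    klDiv (a • Q₁ + b • Q₂) (a • S₁ + b • S₂) ≤ a * klDiv Q₁ S₁ + b * klDiv Q₂ S₂ := by
  by_cases htop : a * klDiv Q₁ S₁ + b * klDiv Q₂ S₂ = ∞
  · rw [htop]; exact le_top
  -- The case `a = 0` is separate: the divergence may then be infinite while the product is 0.
  have key : ∀ {Q S : Measure α} [IsFiniteMeasure Q] [IsFiniteMeasure S] (a : ℝ≥0) {f : α → ℝ},
      Measurable f → (∃ M, ∀ x, |f x| ≤ M) → (a : ℝ≥0∞) * klDiv Q S ≠ ∞ →
      a * dualKL Q S f ≤ ((a : ℝ≥0∞) * klDiv Q S).toReal := by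
    intro Q S _ _ a f hf ⟨M, hM⟩ h
    rcases eq_or_ne a 0 with rfl | ha
    · simp
    have hk : klDiv Q S ≠ ∞ := fun hk => h (by rw [hk, ENNReal.mul_top (by simpa using ha)])
    rw [ENNReal.toReal_mul, ENNReal.coe_toReal]
    gcongr
    exact (ENNReal.ofReal_le_iff_le_toReal hk).1 (dualKL_le_klDiv hf hM)
  rw [ENNReal.add_eq_top, not_or] at htop
  rw [← ENNReal.ofReal_toReal (ENNReal.add_ne_top.2 htop), ENNReal.toReal_add htop.1 htop.2]
  refine klDiv_le_of_dualKL_le fun f hf ⟨M, hM'⟩ => ?_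
  rw [dualKL_smul_add_smul a b hf hM']
  exact add_le_add (key a hf ⟨M, hM'⟩ htop.1) (key b hf ⟨M, hM'⟩ htop.2)

/-- If `Q ≤ c S` then `klDiv Q S` is finite. -/
lemma klDiv_ne_top_of_le_smul {α : Type*} [MeasurableSpace α] {Q S : Measure α} [IsFiniteMeasure Q]
    [IsFiniteMeasure S] (c : ℝ≥0) (h : Q ≤ c • S) : klDiv Q S ≠ ∞ := by
  have hac : Q ≪ S := (Measure.absolutelyContinuous_of_le h).trans
    (Measure.AbsolutelyContinuous.rfl.smul_left c)
  have hr : ∀ᵐ x ∂S, Q.rnDeriv S x ≤ c := by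
    refine ae_le_of_forall_setLIntegral_le_of_sigmaFinite (Measure.measurable_rnDeriv _ _)
      fun s hs _ => ?_
    rw [setLIntegral_const]
    refine (Measure.setLIntegral_rnDeriv_le s).trans ((h s).trans (le_of_eq ?_))
    simp
  obtain ⟨B, hB⟩ := (isCompact_Icc (a := (0 : ℝ)) (b := c)).exists_bound_of_continuousOn
    continuous_klFun.continuousOn
  rw [klDiv_eq_lintegral_klFun_of_ac hac]
  refine ne_top_of_le_ne_top (b := ∫⁻ _, ENNReal.ofReal B ∂S) ?_ (lintegral_mono_ae ?_)
  · rw [lintegral_const]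
    exact ENNReal.mul_ne_top ENNReal.ofReal_ne_top (measure_ne_top _ _)
  · filter_upwards [hr] with x hx
    refine ENNReal.ofReal_le_ofReal ((le_abs_self _).trans (hB _ ⟨ENNReal.toReal_nonneg, ?_⟩))
    exact ENNReal.toReal_le_of_le_ofReal c.2 (by simpa using hx)

/-- The Kullback-Leibler divergence is lower semicontinuous for weak convergence. -/
lemma lowerSemicontinuous_klDiv {α : Type*} [MeasurableSpace α] [TopologicalSpace α]
    [TopologicalSpace.PseudoMetrizableSpace α] [BorelSpace α] :
    LowerSemicontinuous fun p : ProbabilityMeasure α × ProbabilityMeasure α =>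
      klDiv (p.1 : Measure α) (p.2 : Measure α) := by
  -- The divergence as a supremum, over bounded continuous `f`, of functionals continuous for weak
  -- convergence.
  have e : (fun p : ProbabilityMeasure α × ProbabilityMeasure α =>
      klDiv (p.1 : Measure α) (p.2 : Measure α)) =
      fun p => ⨆ f : α →ᵇ ℝ, ENNReal.ofReal (dualKL (p.1 : Measure α) (p.2 : Measure α) f) := by
    funext p
    refine le_antisymm ?_ (iSup_le fun f => dualKL_le_klDiv f.continuous.measurable
      (M := ‖f‖) fun x => by simpa using f.norm_coe_le_norm x)
    by_cases ht : (⨆ f : α →ᵇ ℝ, ENNReal.ofReal (dualKL (p.1 : Measure α) (p.2 : Measure α) f)) = ∞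
    · rw [ht]; exact le_top
    rw [← ENNReal.ofReal_toReal ht]
    refine klDiv_le_of_dualKL_boundedContinuous_le fun f => ?_
    exact (ENNReal.ofReal_le_iff_le_toReal ht).1
      (le_iSup (fun f : α →ᵇ ℝ => ENNReal.ofReal (dualKL (p.1 : Measure α) (p.2 : Measure α) f)) f)
  rw [e]
  refine lowerSemicontinuous_iSup fun f => Continuous.lowerSemicontinuous ?_
  let g : α →ᵇ ℝ := BoundedContinuousFunction.ofNormedAddCommGroup
    (fun x => Real.exp (f x) - 1) (by fun_prop) (Real.exp ‖f‖ + 1) fun x => by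
      have h1 : Real.exp (f x) ≤ Real.exp ‖f‖ :=
        Real.exp_le_exp.2 ((le_abs_self _).trans (f.norm_coe_le_norm x))
      have h2 := Real.exp_pos (f x)
      rw [Real.norm_eq_abs, abs_le]
      constructor <;> linarith
  have h1 := (ProbabilityMeasure.continuous_integral_boundedContinuousFunction f).comp
    (continuous_fst (X := ProbabilityMeasure α) (Y := ProbabilityMeasure α))
  have h2 := (ProbabilityMeasure.continuous_integral_boundedContinuousFunction g).comp
    (continuous_snd (X := ProbabilityMeasure α) (Y := ProbabilityMeasure α))
  exact ENNReal.continuous_ofReal.comp (h1.sub h2)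

end Consequences

/-! ### Quantizers -/

/-- Density of simple functions in `L²`. It supplies the finite-information competitors in both
settings. -/
lemma exists_simpleFunc_lintegral_sq_sub_le {α F : Type*} [MeasurableSpace α]
    [NormedAddCommGroup F] [MeasurableSpace F] [BorelSpace F] {μ : Measure α} {g : α → F}
    (hg : MemLp g 2 μ) {ε : ℝ≥0∞} (hε : ε ≠ 0) :
    ∃ q : SimpleFunc α F, ∫⁻ x, ENNReal.ofReal (‖g x - q x‖ ^ 2) ∂μ ≤ ε := by
  have h2 : ε ^ (2⁻¹ : ℝ) ≠ 0 := by
    intro h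
    rw [ENNReal.rpow_eq_zero_iff] at h
    rcases h with h | h
    · exact hε h.1
    · norm_num at h
  obtain ⟨q, hq, -⟩ := hg.exists_simpleFunc_eLpNorm_sub_lt (by norm_num) h2
  refine ⟨q, ?_⟩
  rw [eLpNorm_eq_lintegral_rpow_enorm_toReal (by norm_num) (by norm_num)] at hq
  simp only [ENNReal.toReal_ofNat, one_div] at hq
  have := (ENNReal.rpow_lt_rpow_iff (by norm_num)).1 hq
  refine le_trans (le_of_eq (lintegral_congr fun x => ?_)) this.le
  rw [ENNReal.ofReal_pow (norm_nonneg _), ofReal_norm]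
  norm_cast

/-- A finitely valued function of a random variable carries finite information about it. -/
lemma klDiv_map_simpleFunc_ne_top {α F : Type*} [MeasurableSpace α] [MeasurableSpace F]
    [MeasurableSingletonClass F] (μ : Measure α) [IsProbabilityMeasure μ] (q : SimpleFunc α F) :
    klDiv (μ.map fun x => (x, q x)) (μ.prod (μ.map q)) ≠ ∞ := by
  classical
  have hq := q.measurable
  have : IsProbabilityMeasure (μ.map q) := Measure.isProbabilityMeasure_map hq.aemeasurable
  have : IsProbabilityMeasure (μ.map fun x => (x, q x)) :=
    Measure.isProbabilityMeasure_map (by fun_prop)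
  -- On `{q = v}`, of mass `p`, the joint law is at most `p⁻¹` times the product law. Values of mass
  -- 0 contribute `0⁻¹ = 0` to the sum and are not charged by the joint law.
  refine klDiv_ne_top_of_le_smul (∑ v ∈ q.range, ((μ (q ⁻¹' {v})).toNNReal)⁻¹)
    (Measure.le_iff.2 fun s hs => ?_)
  have hsl : ∀ v, MeasurableSet {x | (x, v) ∈ s} := fun v => measurable_prodMk_right hs
  have e1 : (μ.map fun x => (x, q x)) s = ∑ v ∈ q.range, μ (q ⁻¹' {v} ∩ {x | (x, v) ∈ s}) := by
    rw [Measure.map_apply (by fun_prop) hs, ← measure_biUnion_finset]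
    · congr 1
      ext x
      simp only [Set.mem_preimage, SimpleFunc.mem_range, Set.mem_iUnion, Set.mem_inter_iff,
        Set.mem_singleton_iff, Set.mem_ofPred_eq, exists_prop]
      exact ⟨fun h => ⟨q x, ⟨x, rfl⟩, rfl, h⟩, fun ⟨v, _, hv, h⟩ => hv ▸ h⟩
    · intro v _ w _ hvw
      refine Set.disjoint_left.2 fun x hx hx' => hvw ?_
      exact hx.1.symm.trans hx'.1
    · intro v _
      exact (q.measurableSet_fiber v).inter (hsl v)
  have e2 : (μ.prod (μ.map q)) s = ∑ v ∈ q.range, μ {x | (x, v) ∈ s} * μ (q ⁻¹' {v}) := by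
    rw [Measure.prod_apply_symm hs, lintegral_map (measurable_measure_prodMk_right hs) hq]
    have := (q.map fun v => μ ((fun x => (x, v)) ⁻¹' s)).lintegral_eq_lintegral μ
    rw [SimpleFunc.map_lintegral] at this
    exact this
  rw [e1, Measure.smul_apply, e2, Finset.smul_sum]
  refine Finset.sum_le_sum fun v hv => ?_
  rcases eq_or_ne (μ (q ⁻¹' {v})) 0 with h0 | h0
  · rw [measure_mono_null Set.inter_subset_left h0]
    exact zero_le
  · have hp : ((μ (q ⁻¹' {v})).toNNReal : ℝ≥0∞) = μ (q ⁻¹' {v}) :=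
      ENNReal.coe_toNNReal (measure_ne_top _ _)
    have hp0 : (μ (q ⁻¹' {v})).toNNReal ≠ 0 := fun h => h0 (by rw [← hp, h]; rfl)
    calc μ (q ⁻¹' {v} ∩ {x | (x, v) ∈ s}) ≤ μ {x | (x, v) ∈ s} :=
          measure_mono Set.inter_subset_right
      _ = ((μ (q ⁻¹' {v})).toNNReal)⁻¹ • (μ {x | (x, v) ∈ s} * μ (q ⁻¹' {v})) := by
        rw [ENNReal.smul_def, smul_eq_mul, ← hp, ENNReal.toNNReal_coe, mul_comm (μ _), ← mul_assoc,
          ← ENNReal.coe_mul, inv_mul_cancel₀ hp0]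
        simp
      _ ≤ _ := by
        have : ((μ (q ⁻¹' {v})).toNNReal)⁻¹ ≤ ∑ v ∈ q.range, ((μ (q ⁻¹' {v})).toNNReal)⁻¹ :=
          Finset.single_le_sum (f := fun v => ((μ (q ⁻¹' {v})).toNNReal)⁻¹)
            (fun _ _ => zero_le) hv
        gcongr

/-! ### Existence of an optimal joint law -/

/-- The positive part of `d` is the increasing limit of its bounded continuous truncations at `n`,
so the integral is a supremum of continuous functionals of the law. -/
lemma lowerSemicontinuous_lintegral_ofReal {α : Type*} [MeasurableSpace α] [TopologicalSpace α]
    [OpensMeasurableSpace α] {d : α → ℝ} (hd : Continuous d) :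
    LowerSemicontinuous fun Q : ProbabilityMeasure α => ∫⁻ x, ENNReal.ofReal (d x) ∂(Q : Measure α) := by
  let f : ℕ → α →ᵇ ℝ≥0 := fun n => BoundedContinuousFunction.mkOfBound
    ⟨fun x => min (d x).toNNReal n, by fun_prop⟩ n fun x y => by
      change dist (min (d x).toNNReal (n : ℝ≥0)) (min (d y).toNNReal (n : ℝ≥0)) ≤ n
      rw [NNReal.dist_eq, abs_le]
      have h1 : (min (d x).toNNReal (n : ℝ≥0) : ℝ≥0) ≤ n := min_le_right _ _
      have h2 : (min (d y).toNNReal (n : ℝ≥0) : ℝ≥0) ≤ n := min_le_right _ _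
      have h1' : ((min (d x).toNNReal (n : ℝ≥0) : ℝ≥0) : ℝ) ≤ n := by exact_mod_cast h1
      have h2' : ((min (d y).toNNReal (n : ℝ≥0) : ℝ≥0) : ℝ) ≤ n := by exact_mod_cast h2
      have h3 := (min (d x).toNNReal (n : ℝ≥0)).coe_nonneg
      have h4 := (min (d y).toNNReal (n : ℝ≥0)).coe_nonneg
      constructor <;> linarith
  have hf : ∀ n x, f n x = min (d x).toNNReal n := fun _ _ => rfl
  have e : (fun Q : ProbabilityMeasure α => ∫⁻ x, ENNReal.ofReal (d x) ∂(Q : Measure α)) =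
      fun Q : ProbabilityMeasure α => ⨆ n, ∫⁻ x, f n x ∂(Q : Measure α) := by
    funext Q
    rw [← lintegral_iSup]
    · refine lintegral_congr fun x => ?_
      refine le_antisymm ?_ (iSup_le fun n => ?_)
      · obtain ⟨n, hn⟩ := exists_nat_ge (d x).toNNReal
        refine le_iSup_of_le n ?_
        rw [hf, min_eq_left hn]
        rfl
      · rw [hf]
        exact ENNReal.coe_le_coe.2 (min_le_left _ _)
    · exact fun n => (f n).continuous.measurable.coe_nnreal_ennreal
    · intro n n' h x
      simp only [hf]
      exact ENNReal.coe_le_coe.2 (min_le_min_left _ (by exact_mod_cast h))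
  rw [e]
  exact lowerSemicontinuous_iSup fun n =>
    (ProbabilityMeasure.continuous_lintegral_boundedContinuousFunction (f n)).lowerSemicontinuous

/-- Chebyshev's inequality bounds the mass outside the ball of radius `r` by `M / r ^ 2`, uniformly
over `S`. -/
lemma isTightMeasureSet_of_lintegral_sq_le {E : Type*} [NormedAddCommGroup E] [ProperSpace E]
    [MeasurableSpace E] [BorelSpace E] {S : Set (Measure E)} {M : ℝ≥0∞} (hM : M ≠ ∞)
    (h : ∀ μ ∈ S, ∫⁻ x, ENNReal.ofReal (‖x‖ ^ 2) ∂μ ≤ M) : IsTightMeasureSet S := by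
  refine isTightMeasureSet_of_tendsto_measure_norm_gt ?_
  have hlim : Tendsto (fun r : ℝ => M / ENNReal.ofReal (r ^ 2)) atTop (𝓝 0) := by
    have h1 : Tendsto (fun r : ℝ => ENNReal.ofReal (r ^ 2)) atTop (𝓝 ∞) :=
      ENNReal.tendsto_ofReal_atTop.comp (tendsto_pow_atTop (by norm_num))
    simpa using ENNReal.Tendsto.div tendsto_const_nhds (Or.inr (by simp)) h1 (Or.inr hM)
  refine tendsto_of_tendsto_of_tendsto_of_le_of_le' tendsto_const_nhds hlim
    (Eventually.of_forall fun _ => zero_le) ?_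
  filter_upwards [eventually_gt_atTop 0] with r hr
  refine iSup₂_le fun μ hμ => ?_
  have hr2 : 0 < r ^ 2 := by positivity
  rw [ENNReal.le_div_iff_mul_le (Or.inl (by simpa using hr.ne')) (Or.inl ENNReal.ofReal_ne_top), mul_comm]
  refine le_trans ?_ (h μ hμ)
  refine le_trans ?_ (mul_meas_ge_le_lintegral (by fun_prop) (ENNReal.ofReal (r ^ 2)))
  gcongr with x
  intro hx
  exact ENNReal.ofReal_le_ofReal (pow_le_pow_left₀ hr.le hx.le 2)

/-- Among the joint laws with prescribed first marginal and bounded distortion, one minimizes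
mutual information. -/
theorem exists_min_klDiv {E : Type*} [NormedAddCommGroup E] [ProperSpace E]
    [SecondCountableTopology E] [MeasurableSpace E] [BorelSpace E]
    (μ : Measure E) [IsProbabilityMeasure μ] (hμ : MemLp id 2 μ) {d : E × E → ℝ}
    (hd : Continuous d) (hlow : ∀ p, ‖p.1 - p.2‖ ^ 2 ≤ d p) {C : ℝ}
    (hup : ∀ p, d p ≤ C * ‖p.1 - p.2‖ ^ 2) {D : ℝ≥0∞} (hD : D ≠ 0) (hD' : D ≠ ∞) :
    ∃ Q : Measure (E × E), Q.map Prod.fst = μ ∧ ∫⁻ p, ENNReal.ofReal (d p) ∂Q ≤ D ∧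
      klDiv Q (μ.prod (Q.map Prod.snd)) ≠ ∞ ∧
      ∀ Q' : Measure (E × E), Q'.map Prod.fst = μ → ∫⁻ p, ENNReal.ofReal (d p) ∂Q' ≤ D →
        klDiv Q (μ.prod (Q.map Prod.snd)) ≤ klDiv Q' (μ.prod (Q'.map Prod.snd)) := by
  -- The candidates form a nonempty compact set by Prokhorov's theorem, and the lower semicontinuous
  -- `F` attains its minimum there.
  let K : Set (ProbabilityMeasure (E × E)) :=
    {Q | (Q : Measure (E × E)).map Prod.fst = μ ∧ ∫⁻ p, ENNReal.ofReal (d p) ∂(Q : Measure (E × E)) ≤ D}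
  have hprob : ∀ Q' : Measure (E × E), Q'.map Prod.fst = μ → IsProbabilityMeasure Q' := by
    intro Q' h
    constructor
    have := congrArg (fun ν : Measure E => ν Set.univ) h
    simpa [Measure.map_apply measurable_fst MeasurableSet.univ] using this
  let N : ProbabilityMeasure E := ⟨μ, inferInstance⟩
  let F : ProbabilityMeasure (E × E) → ℝ≥0∞ := fun Q =>
    klDiv (Q : Measure (E × E)) (μ.prod ((Q : Measure (E × E)).map Prod.snd))
  have hF : LowerSemicontinuous F := by
    have h1 : Continuous fun Q : ProbabilityMeasure (E × E) =>
        (Q, N.prod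
          (Q.map measurable_snd.aemeasurable)) :=
      continuous_id.prodMk (ProbabilityMeasure.continuous_prod.comp
        (continuous_const.prodMk (ProbabilityMeasure.continuous_map continuous_snd)))
    exact LowerSemicontinuous.comp lowerSemicontinuous_klDiv h1
  have hKclosed : IsClosed K := by
    have h1 : IsClosed {Q : ProbabilityMeasure (E × E) |
        Q.map measurable_fst.aemeasurable = N} :=
      isClosed_eq (ProbabilityMeasure.continuous_map continuous_fst) continuous_const
    have h2 : IsClosed {Q : ProbabilityMeasure (E × E) |
        ∫⁻ p, ENNReal.ofReal (d p) ∂(Q : Measure (E × E)) ≤ D} :=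
      (lowerSemicontinuous_lintegral_ofReal hd).isClosed_preimage D
    convert h1.inter h2 using 1
    ext Q
    simp only [K, Set.mem_ofPred_eq, Set.mem_inter_iff]
    exact and_congr_left' (ProbabilityMeasure.toMeasure_injective.eq_iff
      (a := Q.map measurable_fst.aemeasurable) (b := N))
  have hμ2 : ∫⁻ x, ENNReal.ofReal (‖x‖ ^ 2) ∂μ ≠ ∞ := by
    simpa using (hμ.integrable_norm_pow (by norm_num)).lintegral_lt_top.ne
  -- Since `‖y‖² ≤ 2‖x‖² + 2‖x - y‖²` and `‖x - y‖² ≤ d`, the sup norm of the pair satisfies `‖(x,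
  -- y)‖² ≤ 3‖x‖² + 2d`.
  have hKtight : IsTightMeasureSet {((Q : ProbabilityMeasure (E × E)) : Measure (E × E)) | Q ∈ K} := by
    refine isTightMeasureSet_of_lintegral_sq_le
      (M := 3 * ∫⁻ x, ENNReal.ofReal (‖x‖ ^ 2) ∂μ + 2 * D)
      (ENNReal.add_ne_top.2 ⟨ENNReal.mul_ne_top (by norm_num) hμ2,
        ENNReal.mul_ne_top (by norm_num) hD'⟩) ?_
    rintro _ ⟨Q, ⟨hQ1, hQ2⟩, rfl⟩
    calc ∫⁻ p, ENNReal.ofReal (‖p‖ ^ 2) ∂(Q : Measure (E × E))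
        ≤ ∫⁻ p, (3 * ENNReal.ofReal (‖p.1‖ ^ 2) + 2 * ENNReal.ofReal (d p))
            ∂(Q : Measure (E × E)) := by
          refine lintegral_mono fun p => ?_
          have h3 : (3 : ℝ≥0∞) = ENNReal.ofReal 3 := by simp
          have h2 : (2 : ℝ≥0∞) = ENNReal.ofReal 2 := by simp
          rw [h3, h2, ← ENNReal.ofReal_mul (by norm_num), ← ENNReal.ofReal_mul (by norm_num),
            ← ENNReal.ofReal_add (by positivity)
              (mul_nonneg (by norm_num) ((sq_nonneg _).trans (hlow p)))]
          refine ENNReal.ofReal_le_ofReal ?_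
          have hl := hlow p
          have ht : ‖p.2‖ ≤ ‖p.1‖ + ‖p.1 - p.2‖ := by
            have := norm_sub_le p.1 (p.1 - p.2)
            rwa [sub_sub_cancel] at this
          have n1 := norm_nonneg p.1
          have n2 := norm_nonneg p.2
          have n3 := norm_nonneg (p.1 - p.2)
          rcases max_choice ‖p.1‖ ‖p.2‖ with h | h <;> rw [Prod.norm_def, h]
          · nlinarith
          · have := mul_self_le_mul_self n2 ht
            nlinarith [sq_nonneg (‖p.1‖ - ‖p.1 - p.2‖)]
      _ = 3 * ∫⁻ x, ENNReal.ofReal (‖x‖ ^ 2) ∂μ +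
            2 * ∫⁻ p, ENNReal.ofReal (d p) ∂(Q : Measure (E × E)) := by
          rw [lintegral_add_left (by fun_prop), lintegral_const_mul _ (by fun_prop),
            lintegral_const_mul _ (by have := hd.measurable; fun_prop), ← hQ1,
            lintegral_map (by fun_prop) measurable_fst]
      _ ≤ _ := by gcongr
  have hKcompact : IsCompact K := by
    have := isCompact_closure_of_isTightMeasureSet hKtight
    rwa [hKclosed.closure_eq] at this
  have hC : 0 < max C 1 := lt_max_of_lt_right one_pos
  -- A fine quantizer is a candidate of finite information. The maximum with 1 keeps the divisor
  -- positive.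
  obtain ⟨q, hq⟩ := exists_simpleFunc_lintegral_sq_sub_le hμ
    (ε := D / ENNReal.ofReal (max C 1)) (ENNReal.div_ne_zero.2 ⟨hD, ENNReal.ofReal_ne_top⟩)
  have hqm := q.measurable
  let Q₀ : Measure (E × E) := μ.map fun x => (x, q x)
  have hQ₀1 : Q₀.map Prod.fst = μ := by
    rw [Measure.map_map measurable_fst (by fun_prop)]
    exact Measure.map_id
  have hQ₀2 : Q₀.map Prod.snd = μ.map q := by
    rw [Measure.map_map measurable_snd (by fun_prop)]
    rfl
  have hdm := hd.measurable
  have hQ₀3 : ∫⁻ p, ENNReal.ofReal (d p) ∂Q₀ ≤ D := by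
    rw [lintegral_map (by fun_prop) (by fun_prop)]
    calc ∫⁻ x, ENNReal.ofReal (d (x, q x)) ∂μ
        ≤ ∫⁻ x, ENNReal.ofReal (max C 1) * ENNReal.ofReal (‖x - q x‖ ^ 2) ∂μ := by
          refine lintegral_mono fun x => ?_
          rw [← ENNReal.ofReal_mul hC.le]
          refine ENNReal.ofReal_le_ofReal ((hup _).trans ?_)
          gcongr
          exact le_max_left _ _
      _ = ENNReal.ofReal (max C 1) * ∫⁻ x, ENNReal.ofReal (‖x - q x‖ ^ 2) ∂μ :=
          lintegral_const_mul _ (by fun_prop)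
      _ ≤ ENNReal.ofReal (max C 1) * (D / ENNReal.ofReal (max C 1)) := by
          gcongr
          exact hq
      _ ≤ D := ENNReal.mul_div_le
  have := hprob Q₀ hQ₀1
  let P₀ : ProbabilityMeasure (E × E) := ⟨Q₀, this⟩
  have hne : P₀ ∈ K := ⟨hQ₀1, hQ₀3⟩
  obtain ⟨Q, hQK, hQmin⟩ := (hF.lowerSemicontinuousOn K).exists_isMinOn ⟨_, hne⟩ hKcompact
  refine ⟨Q, hQK.1, hQK.2, ?_, fun Q' h1 h2 => ?_⟩
  · refine ne_top_of_le_ne_top ?_ (hQmin hne)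
    change klDiv Q₀ (μ.prod (Q₀.map Prod.snd)) ≠ ∞
    rw [hQ₀2]
    exact klDiv_map_simpleFunc_ne_top μ q
  · have := hprob Q' h1
    let P' : ProbabilityMeasure (E × E) := ⟨Q', this⟩
    have hP' : P' ∈ K := ⟨h1, h2⟩
    exact hQmin hP'

variable {m : ℕ}

/-! ### Gaussian vectors and their mixtures -/

section Gaussian

variable {ι : Type*} [Fintype ι] [DecidableEq ι] {τ : Matrix ι ι ℝ}

lemma memLp_eval_gaussian (τ : Matrix ι ι ℝ) (i : ι) :
    MemLp (fun x : EuclideanSpace ℝ ι => x i) 2 (multivariateGaussian 0 τ) :=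
  (EuclideanSpace.proj i : EuclideanSpace ℝ ι →L[ℝ] ℝ).comp_memLp' IsGaussian.memLp_two_id

lemma integral_eval_gaussian (τ : Matrix ι ι ℝ) (i : ι) :
    ∫ x, x i ∂(multivariateGaussian (0 : EuclideanSpace ℝ ι) τ) = 0 := by
  have := (EuclideanSpace.proj i : EuclideanSpace ℝ ι →L[ℝ] ℝ).integral_comp_id_comm
    (IsGaussian.integrable_id (μ := multivariateGaussian (0 : EuclideanSpace ℝ ι) τ))
  simpa using this

lemma integral_mul_gaussian (hτ : τ.PosSemidef) (i j : ι) :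
    ∫ x, x i * x j ∂(multivariateGaussian (0 : EuclideanSpace ℝ ι) τ) = τ i j := by
  have h := covariance_eval_multivariateGaussian (μ := (0 : EuclideanSpace ℝ ι)) hτ i j
  rw [covariance_eq_sub (memLp_eval_gaussian τ i) (memLp_eval_gaussian τ j),
    integral_eval_gaussian, zero_mul, sub_zero] at h
  exact h

lemma lintegral_norm_sq_gaussian (hτ : τ.PosSemidef) :
    ∫⁻ x, ENNReal.ofReal (‖x‖ ^ 2) ∂(multivariateGaussian (0 : EuclideanSpace ℝ ι) τ) =
      ENNReal.ofReal τ.trace := by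
  rw [← ofReal_integral_eq_lintegral_ofReal]
  · congr 1
    simp only [EuclideanSpace.real_norm_sq_eq]
    rw [integral_finsetSum _ fun i _ => (memLp_eval_gaussian τ i).integrable_sq]
    refine Finset.sum_congr rfl fun i _ => ?_
    simp only [sq]
    exact integral_mul_gaussian hτ i i
  · exact (IsGaussian.memLp_two_id (μ := multivariateGaussian (0 : EuclideanSpace ℝ ι) τ)).integrable_norm_pow
      (by norm_num)
  · exact ae_of_all _ fun x => by positivity

end Gaussian

/-- `restr` as a continuous linear map. -/
def restrL (B : Finset (Fin m)) : EuclideanSpace ℝ (Fin m) →L[ℝ] EuclideanSpace ℝ B :=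
  LinearMap.toContinuousLinearMap
    { toFun := restr B, map_add' := fun _ _ => rfl, map_smul' := fun _ _ => rfl }

lemma coe_restrL (B : Finset (Fin m)) : ⇑(restrL B) = restr B := rfl

lemma map_restr_gaussian {τ : Matrix (Fin m) (Fin m) ℝ} (hτ : τ.PosSemidef) (A : Finset (Fin m)) :
    (multivariateGaussian 0 τ).map (restr A) = multivariateGaussian 0 (subCov A τ) := by
  rw [← coe_restrL]
  have hs : (subCov A τ).PosSemidef := hτ.submatrix _
  apply IsGaussian.ext
  · simp only [id_eq, integral_id_multivariateGaussian]
    rw [ContinuousLinearMap.integral_id_map, integral_id_multivariateGaussian, map_zero]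
    exact IsGaussian.integrable_id
  rw [← ContinuousLinearMap.toBilinForm_inj]
  refine LinearMap.BilinForm.ext_basis (EuclideanSpace.basisFun A ℝ).toBasis fun i j ↦ ?_
  rw [ContinuousLinearMap.toBilinForm_apply, ContinuousLinearMap.toBilinForm_apply,
    covarianceBilin_apply_eq_cov, covariance_map]
  · have (i : A) : (fun u ↦ inner ℝ ((EuclideanSpace.basisFun A ℝ).toBasis i) u) ∘
        restrL A = fun u ↦ u i.1 := by
      ext; simp [PiLp.inner_apply, coe_restrL, restr]
    simp_rw [this, covariance_eval_multivariateGaussian hτ,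
      covarianceBilin_multivariateGaussian hs]
    simp [subCov]
  any_goals exact Measurable.aestronglyMeasurable (by fun_prop)
  · fun_prop
  · exact IsGaussian.memLp_two_id

lemma posDef_subCov {τ : Matrix (Fin m) (Fin m) ℝ} (hτ : τ.PosDef) (A : Finset (Fin m)) :
    (subCov A τ).PosDef := hτ.submatrix Subtype.val_injective

/-- Under `N(0, τ)`, the residual of the linear regression of `X_j` on `X_A` is uncorrelated with
every function of `X_A`. -/
lemma setIntegral_residual_gaussian {τ : Matrix (Fin m) (Fin m) ℝ} (hτ : τ.PosDef)
    (A : Finset (Fin m)) (j : Fin m) {s : Set (EuclideanSpace ℝ A)} (hs : MeasurableSet s) :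
    ∫ x in restr A ⁻¹' s, (x j - ∑ k : A, ((subCov A τ)⁻¹ *ᵥ fun i : A => τ i j) k * x k)
      ∂(multivariateGaussian 0 τ) = 0 := by
  set c := (subCov A τ)⁻¹ *ᵥ fun i : A => τ i j with hc
  set N := multivariateGaussian (0 : EuclideanSpace ℝ (Fin m)) τ with hN
  have hsub := posDef_subCov hτ A
  -- `c` solves the normal equations, so the residual `U` is uncorrelated with each coordinate of
  -- `X_A`. Joint Gaussianity upgrades this to independence, and `U` has mean 0.
  have hcm : subCov A τ *ᵥ c = fun i : A => τ i j := by
    rw [hc, Matrix.mulVec_mulVec, Matrix.mul_nonsing_inv _ ((Matrix.isUnit_iff_isUnit_det _).1 hsub.isUnit), Matrix.one_mulVec]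
  let U : EuclideanSpace ℝ (Fin m) →L[ℝ] ℝ := EuclideanSpace.proj j - ∑ k : A, c k • EuclideanSpace.proj (k : Fin m)
  have hU : ∀ x, U x = x j - ∑ k : A, c k * x k := fun x => by
    simp [U]
  let T : EuclideanSpace ℝ (Fin m) →L[ℝ] (A → ℝ) × (Unit → ℝ) :=
    (ContinuousLinearMap.pi fun i : A => EuclideanSpace.proj (i : Fin m)).prod
      (ContinuousLinearMap.pi fun _ => U)
  have hcov : ∀ (i : A) (_ : Unit), cov[fun x : EuclideanSpace ℝ (Fin m) => x i, fun x => U x; N] = 0 := by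
    intro i _
    simp only [hU]
    rw [covariance_fun_sub_right (memLp_eval_gaussian τ _) (memLp_eval_gaussian τ _)
      (memLp_finsetSum _ fun k _ => (memLp_eval_gaussian τ _).const_mul _),
      covariance_fun_sum_right (fun k => (memLp_eval_gaussian τ _).const_mul _)
        (memLp_eval_gaussian τ _)]
    simp only [covariance_const_mul_right, covariance_eval_multivariateGaussian hτ.posSemidef]
    have := congrFun hcm i
    simp only [Matrix.mulVec, dotProduct, subCov, Matrix.submatrix_apply] at this
    rw [← this]
    simp [mul_comm]
  have hind := HasGaussianLaw.indepFun_of_covariance_eval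
    (X := fun (i : A) (x : EuclideanSpace ℝ (Fin m)) => x i) (Y := fun (_ : Unit) x => U x)
    ((IsGaussian.hasGaussianLaw_id (μ := N)).map_fun T) hcov
  let t : Set (A → ℝ) := WithLp.toLp 2 ⁻¹' s
  have ht : MeasurableSet t := (WithLp.measurable_toLp 2 _) hs
  have e := hind.integral_fun_comp_mul_comp (f := t.indicator fun _ => (1 : ℝ)) (g := fun u => u ())
    (by fun_prop) (by fun_prop) ((measurable_const.indicator ht).aestronglyMeasurable)
    (measurable_pi_apply ()).aestronglyMeasurable
  have hz : ∫ x, U x ∂N = 0 := by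
    have := U.integral_comp_id_comm (IsGaussian.integrable_id (μ := N))
    simpa [hN] using this
  rw [hz, mul_zero] at e
  have hs' : MeasurableSet (restr A ⁻¹' s) := measurable_restr A hs
  rw [← integral_indicator hs', ← e]
  refine integral_congr_ae (ae_of_all _ fun x => ?_)
  by_cases hx : restr A x ∈ s
  · have hx' : (fun i : A => x i) ∈ t := hx
    simp [hx, hx', hU]
  · have hx' : (fun i : A => x i) ∉ t := hx
    simp [hx, hx']

section Mixture

variable {Θ : Set (Matrix (Fin m) (Fin m) ℝ)} {A : Finset (Fin m)} {τ₁ : Matrix A A ℝ}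
  {π : Measure (Matrix (Fin m) (Fin m) ℝ)} [IsProbabilityMeasure π]

lemma lintegral_condLawX {f : EuclideanSpace ℝ (Fin m) → ℝ≥0∞} (hf : Measurable f) :
    ∫⁻ x, f x ∂(condLawX π) = ∫⁻ τ, ∫⁻ x, f x ∂(multivariateGaussian 0 τ) ∂π := by
  rw [condLawX, lintegral_map hf measurable_snd, Measure.lintegral_compProd (by fun_prop)]
  rfl

lemma integral_condLawX {f : EuclideanSpace ℝ (Fin m) → ℝ} (hf : Integrable f (condLawX π)) :
    ∫ x, f x ∂(condLawX π) = ∫ τ, ∫ x, f x ∂(multivariateGaussian 0 τ) ∂π := by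
  rw [condLawX] at hf ⊢
  rw [integral_map measurable_snd.aemeasurable hf.aestronglyMeasurable]
  exact Measure.integral_compProd (hf.comp_measurable measurable_snd)

/-- Every `N(0, τ)` with `τ` in the atom has the same marginal on `A`, and mixing preserves it. -/
lemma map_restr_condLawX (hΘ_pd : ∀ τ ∈ Θ, τ.PosDef) (hπ : ∀ᵐ τ ∂π, τ ∈ atom A Θ τ₁)
    : (condLawX π).map (restr A) = multivariateGaussian 0 τ₁ := by
  ext s hs
  rw [← lintegral_indicator_one hs, lintegral_map (measurable_one.indicator hs) (measurable_restr A),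
    lintegral_condLawX (f := fun x => s.indicator 1 (restr A x))
      ((measurable_one.indicator hs).comp (measurable_restr A))]
  have : ∀ᵐ τ ∂π, ∫⁻ x, s.indicator 1 (restr A x) ∂(multivariateGaussian 0 τ) =
      multivariateGaussian 0 τ₁ s := by
    filter_upwards [hπ] with τ hτ
    rw [← lintegral_map (measurable_one.indicator hs) (measurable_restr A),
      map_restr_gaussian (hΘ_pd τ hτ.1).posSemidef, hτ.2, lintegral_indicator_one hs]
  rw [lintegral_congr_ae this]
  simp

/-- The second moment of `N(0, τ)` is the trace of `τ`, which is bounded on the compact `Θ`. -/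
lemma memLp_id_condLawX (hΘ_pd : ∀ τ ∈ Θ, τ.PosDef) (hπ : ∀ᵐ τ ∂π, τ ∈ atom A Θ τ₁)
    (hΘ_compact : IsCompact Θ) : MemLp id 2 (condLawX π) := by
  obtain ⟨b, hb⟩ := hΘ_compact.exists_bound_of_continuousOn
    (f := fun τ : Matrix (Fin m) (Fin m) ℝ => τ.trace) (by fun_prop)
  have h : ∫⁻ x, ENNReal.ofReal (‖x‖ ^ 2) ∂(condLawX π) ≤ ENNReal.ofReal b := by
    rw [lintegral_condLawX (by fun_prop)]
    calc _ ≤ ∫⁻ _, ENNReal.ofReal b ∂π := by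
          refine lintegral_mono_ae ?_
          filter_upwards [hπ] with τ hτ
          rw [lintegral_norm_sq_gaussian (hΘ_pd τ hτ.1).posSemidef]
          exact ENNReal.ofReal_le_ofReal ((le_abs_self _).trans (hb τ hτ.1))
      _ = _ := by simp
  rw [memLp_two_iff_integrable_sq_norm aestronglyMeasurable_id]
  refine ⟨by fun_prop, ?_⟩
  rw [hasFiniteIntegral_iff_ofReal (ae_of_all _ fun x => by positivity)]
  exact h.trans_lt ENNReal.ofReal_lt_top

lemma memLp_eval_of_memLp_id {ι : Type*} [Fintype ι] {μ : Measure (EuclideanSpace ℝ ι)}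
    (h : MemLp id 2 μ) (i : ι) : MemLp (fun x : EuclideanSpace ℝ ι => x i) 2 μ :=
  (EuclideanSpace.proj i : EuclideanSpace ℝ ι →L[ℝ] ℝ).comp_memLp' h

lemma integral_mul_condLawX (hΘ_pd : ∀ τ ∈ Θ, τ.PosDef) (hπ : ∀ᵐ τ ∂π, τ ∈ atom A Θ τ₁)
    (hΘ_compact : IsCompact Θ) (i j : Fin m) :
    ∫ x, x i * x j ∂(condLawX π) = ∫ τ, τ i j ∂π := by
  have h := memLp_id_condLawX hΘ_pd hπ hΘ_compact
  rw [integral_condLawX (f := fun x => x i * x j) ((memLp_eval_of_memLp_id h i).integrable_mul (memLp_eval_of_memLp_id h j))]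
  refine integral_congr_ae ?_
  filter_upwards [hπ] with τ hτ using integral_mul_gaussian (hΘ_pd τ hτ.1).posSemidef i j

lemma integrable_entry (hπ : ∀ᵐ τ ∂π, τ ∈ atom A Θ τ₁) (hΘ_compact : IsCompact Θ) (i j : Fin m) :
    Integrable (fun τ : Matrix (Fin m) (Fin m) ℝ => τ i j) π := by
  have hc : Continuous fun τ : Matrix (Fin m) (Fin m) ℝ => τ i j := by fun_prop
  obtain ⟨b, hb⟩ := hΘ_compact.exists_bound_of_continuousOn hc.continuousOn
  refine Integrable.of_bound (C := b) ?_ ?_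
  · have : Measurable fun τ : Matrix (Fin m) (Fin m) ℝ => τ i j :=
      (measurable_pi_apply j).comp (measurable_pi_apply (X := fun _ : Fin m => Fin m → ℝ) i)
    exact this.aestronglyMeasurable
  · filter_upwards [hπ] with τ hτ using hb τ hτ.1

/-- The coefficients of the regression of `X_{A^c}` on `X_A`. -/
def regCoeff (A : Finset (Fin m)) (π : Measure (Matrix (Fin m) (Fin m) ℝ)) (τ₁ : Matrix A A ℝ) :
    Matrix A ↥(Aᶜ) ℝ := τ₁⁻¹ * crossCov A π

/-- For each `τ` in the atom the regression coefficients are `τ₁⁻¹` times the cross-covariance of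
`τ`, with `τ₁` and the law of `X_A` common to all of them. Averaging over `π` therefore only
replaces the cross-covariance by its mean, and the regression stays linear. -/
lemma setIntegral_condLawX (hΘ_pd : ∀ τ ∈ Θ, τ.PosDef) (hπ : ∀ᵐ τ ∂π, τ ∈ atom A Θ τ₁)
    (hΘ_compact : IsCompact Θ) (j : ↥(Aᶜ))
    {s : Set (EuclideanSpace ℝ A)} (hs : MeasurableSet s) :
    ∫ x in restr A ⁻¹' s, x (j : Fin m) ∂(condLawX π) =
      ∫ x in restr A ⁻¹' s, ∑ k : A, regCoeff A π τ₁ k j * x k ∂(condLawX π) := by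
  have h := memLp_id_condLawX hΘ_pd hπ hΘ_compact
  have hi : ∀ i : Fin m, Integrable (fun x : EuclideanSpace ℝ (Fin m) => x i) (condLawX π) :=
    fun i => (memLp_eval_of_memLp_id h i).integrable (by norm_num)
  have hs' : MeasurableSet (restr A ⁻¹' s) := measurable_restr A hs
  have hsi : ∀ i : Fin m, Integrable
      ((restr A ⁻¹' s).indicator fun x : EuclideanSpace ℝ (Fin m) => x i) (condLawX π) :=
    fun i => (hi i).indicator hs'
  let v : A → ℝ := fun k => ∫ x in s, x k ∂(multivariateGaussian 0 τ₁)
  have hv : ∀ τ ∈ atom A Θ τ₁, ∀ k : A,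
      ∫ x in restr A ⁻¹' s, x (k : Fin m) ∂(multivariateGaussian 0 τ) = v k := by
    intro τ hτ k
    simp only [v]
    rw [← hτ.2, ← map_restr_gaussian (hΘ_pd τ hτ.1).posSemidef,
      setIntegral_map hs (by fun_prop) (measurable_restr A).aemeasurable]
    rfl
  have hvX : ∀ k : A, ∫ x in restr A ⁻¹' s, x (k : Fin m) ∂(condLawX π) = v k := by
    intro k
    simp only [v]
    rw [← map_restr_condLawX hΘ_pd hπ,
      setIntegral_map hs (by fun_prop) (measurable_restr A).aemeasurable]
    rfl
  have hG : ∀ (τ : Matrix (Fin m) (Fin m) ℝ) (i : Fin m), Integrable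
      (fun x : EuclideanSpace ℝ (Fin m) => x i) (multivariateGaussian 0 τ) :=
    fun τ i => (memLp_eval_gaussian τ i).integrable (by norm_num)
  rw [integral_finsetSum _ fun (k : A) _ => ((hi k).const_mul _).integrableOn]
  simp only [integral_const_mul, hvX]
  rw [← integral_indicator hs', integral_condLawX (hsi j)]
  have e : ∀ᵐ τ ∂π, ∫ x, (restr A ⁻¹' s).indicator (fun x : EuclideanSpace ℝ (Fin m) => x (j : Fin m)) x
      ∂(multivariateGaussian 0 τ) = ∑ k : A, (∑ i : A, τ₁⁻¹ k i * τ i j) * v k := by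
    filter_upwards [hπ] with τ hτ
    rw [integral_indicator hs']
    have h0 := setIntegral_residual_gaussian (hΘ_pd τ hτ.1) A j hs
    have hk : ∀ k : A, Integrable (fun x : EuclideanSpace ℝ (Fin m) =>
        ((subCov A τ)⁻¹ *ᵥ fun i : A => τ i j) k * x k)
        ((multivariateGaussian 0 τ).restrict (restr A ⁻¹' s)) :=
      fun k => ((hG τ _).const_mul _).integrableOn
    rw [integral_sub (hG τ _).integrableOn (integrable_finsetSum _ fun k _ => hk k),
      integral_finsetSum _ fun k _ => hk k] at h0
    simp only [integral_const_mul, hv τ hτ] at h0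
    rw [sub_eq_zero.1 h0, hτ.2]
    rfl
  rw [integral_congr_ae e]
  have hint : ∀ k i : A, Integrable (fun τ : Matrix (Fin m) (Fin m) ℝ => τ₁⁻¹ k i * τ i j) π :=
    fun k i => (integrable_entry hπ hΘ_compact _ _).const_mul _
  rw [integral_finsetSum _ fun k _ => (integrable_finsetSum _ fun i _ => hint k i).mul_const (v k)]
  refine Finset.sum_congr rfl fun k _ => ?_
  rw [integral_mul_const, integral_finsetSum _ fun i _ => hint k i]
  congr 1
  rw [regCoeff, Matrix.mul_apply]
  refine Finset.sum_congr rfl fun i _ => ?_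
  rw [integral_const_mul, crossCov, Matrix.of_apply, integral_mul_condLawX hΘ_pd hπ hΘ_compact]

end Mixture

/-! ### Decomposition of the distortion -/

lemma norm_sub_sq_eq_restr (A : Finset (Fin m)) (x y : EuclideanSpace ℝ (Fin m)) :
    ‖x - y‖ ^ 2 = ‖restr A x - restr A y‖ ^ 2 + ‖restr Aᶜ x - restr Aᶜ y‖ ^ 2 := by
  simp only [EuclideanSpace.real_norm_sq_eq]
  rw [← Finset.sum_add_sum_compl A, ← Finset.sum_coe_sort A, ← Finset.sum_coe_sort Aᶜ]
  rfl

lemma restr_glue (A : Finset (Fin m)) (p : EuclideanSpace ℝ A × EuclideanSpace ℝ ↥(Aᶜ)) :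
    restr A (glue A p) = p.1 := by
  ext i
  simp [restr, glue]

lemma restr_compl_glue (A : Finset (Fin m)) (p : EuclideanSpace ℝ A × EuclideanSpace ℝ ↥(Aᶜ)) :
    restr Aᶜ (glue A p) = p.2 := by
  ext i
  have := Finset.mem_compl.1 i.2
  simp [restr, glue, this]

-- The bias-variance identity

section BiasVariance

variable {E : Type*} [NormedAddCommGroup E] [InnerProductSpace ℝ E] [CompleteSpace E]
  [MeasurableSpace E]

/-- Expanding the square around the mean leaves a cross term linear in `z - a`, which integrates to
0. -/
lemma lintegral_norm_sub_sq_eq {ν : Measure E} [IsProbabilityMeasure ν] (hν : MemLp id 2 ν) (y : E) :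
    ∫⁻ z, ENNReal.ofReal (‖z - y‖ ^ 2) ∂ν =
      ∫⁻ z, ENNReal.ofReal (‖z - ∫ w, w ∂ν‖ ^ 2) ∂ν + ENNReal.ofReal (‖(∫ w, w ∂ν) - y‖ ^ 2) := by
  set a := ∫ w, w ∂ν with ha
  have hi : Integrable (fun z : E => z) ν := hν.integrable (by norm_num)
  have hsq : ∀ b : E, Integrable (fun z => ‖z - b‖ ^ 2) ν := fun b =>
    (hν.sub (memLp_const b)).integrable_norm_pow (by norm_num)
  rw [← ofReal_integral_eq_lintegral_ofReal (hsq y) (ae_of_all _ fun z => by positivity),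
    ← ofReal_integral_eq_lintegral_ofReal (hsq a) (ae_of_all _ fun z => by positivity),
    ← ENNReal.ofReal_add (integral_nonneg fun z => by positivity) (by positivity)]
  congr 1
  have e : ∀ z : E, ‖z - y‖ ^ 2 = (‖z - a‖ ^ 2 + ‖a - y‖ ^ 2) + 2 * inner ℝ (a - y) (z - a) := by
    intro z
    have : z - y = (z - a) + (a - y) := by abel
    rw [this, norm_add_sq_real, real_inner_comm]
    ring
  rw [integral_congr_ae (ae_of_all _ e)]
  have hz : Integrable (fun z => z - a) ν := hi.sub (integrable_const a)
  have hab : Integrable (fun z => ‖z - a‖ ^ 2 + ‖a - y‖ ^ 2) ν := (hsq a).add (integrable_const _)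
  rw [integral_add hab ((hz.const_inner _).const_mul 2),
    integral_add (hsq a) (integrable_const _), integral_const_mul, integral_inner hz,
    integral_sub hi (integrable_const a), ← ha, integral_const, integral_const]
  rw [probReal_univ, one_smul, one_smul, sub_self, inner_zero_right, mul_zero, add_zero]

lemma memLp_id_of_lintegral_lt_top {E : Type*} [NormedAddCommGroup E] [MeasurableSpace E]
    [BorelSpace E] [SecondCountableTopology E] {ν : Measure E} [IsFiniteMeasure ν] {y : E}
    (h : ∫⁻ z, ENNReal.ofReal (‖z - y‖ ^ 2) ∂ν < ∞) : MemLp id 2 ν := by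
  have h1 : MemLp (fun z : E => z - y) 2 ν := by
    rw [memLp_two_iff_integrable_sq_norm (by fun_prop)]
    refine ⟨by fun_prop, ?_⟩
    rwa [hasFiniteIntegral_iff_ofReal (ae_of_all _ fun x => by positivity)]
  have := h1.add (memLp_const y)
  exact this.congr_norm aestronglyMeasurable_id (ae_of_all _ fun z => by simp)

end BiasVariance

/-- Linear regression of `X_{A^c}` on `X_A`. -/
def regL (A : Finset (Fin m)) (π : Measure (Matrix (Fin m) (Fin m) ℝ)) (τ₁ : Matrix A A ℝ) :
    EuclideanSpace ℝ A →L[ℝ] EuclideanSpace ℝ ↥(Aᶜ) :=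
  LinearMap.toContinuousLinearMap (Matrix.toEuclideanLin (regCoeff A π τ₁)ᵀ)

lemma regL_apply (A : Finset (Fin m)) (π : Measure (Matrix (Fin m) (Fin m) ℝ)) (τ₁ : Matrix A A ℝ)
    (x : EuclideanSpace ℝ A) (j : ↥(Aᶜ)) : regL A π τ₁ x j = ∑ k : A, regCoeff A π τ₁ k j * x k := by
  simp [regL, Matrix.mulVec, dotProduct]

-- Conditional mean of the unsampled components and the minimal error

section Bayes

variable {Θ : Set (Matrix (Fin m) (Fin m) ℝ)} {A : Finset (Fin m)} {τ₁ : Matrix A A ℝ}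
  {π : Measure (Matrix (Fin m) (Fin m) ℝ)} [IsProbabilityMeasure π]

lemma compProd_condDistrib_condLawX (hΘ_pd : ∀ τ ∈ Θ, τ.PosDef) (hπ : ∀ᵐ τ ∂π, τ ∈ atom A Θ τ₁) :
    multivariateGaussian 0 τ₁ ⊗ₘ condDistrib (restr Aᶜ) (restr A) (condLawX π) =
      (condLawX π).map fun x => (restr A x, restr Aᶜ x) := by
  rw [← map_restr_condLawX hΘ_pd hπ,
    compProd_map_condDistrib (measurable_restr Aᶜ).aemeasurable]

/-- The conditional law of `X_{A^c}` given `X_A` has finite second moment, and its mean is the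
linear regression. -/
lemma condDistrib_condLawX_mean (hΘ_pd : ∀ τ ∈ Θ, τ.PosDef) (hπ : ∀ᵐ τ ∂π, τ ∈ atom A Θ τ₁)
    (hΘ_compact : IsCompact Θ) :
    ∀ᵐ x ∂(multivariateGaussian 0 τ₁),
      MemLp id 2 (condDistrib (restr Aᶜ) (restr A) (condLawX π) x) ∧
      ∫ z, z ∂(condDistrib (restr Aᶜ) (restr A) (condLawX π) x) = regL A π τ₁ x := by
  set R := condDistrib (restr Aᶜ) (restr A) (condLawX π) with hR
  set N := multivariateGaussian (0 : EuclideanSpace ℝ A) τ₁ with hN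
  have hJ : N ⊗ₘ R = (condLawX π).map fun x => (restr A x, restr Aᶜ x) :=
    compProd_condDistrib_condLawX hΘ_pd hπ
  have hm : Measurable fun x => (restr A x, restr Aᶜ x) :=
    (measurable_restr A).prodMk (measurable_restr Aᶜ)
  have h2 := memLp_id_condLawX hΘ_pd hπ hΘ_compact
  have hmem : ∀ᵐ x ∂N, MemLp id 2 (R x) := by
    have hfin : ∫⁻ x, ∫⁻ z, ENNReal.ofReal (‖z - 0‖ ^ 2) ∂(R x) ∂N ≠ ∞ := by
      rw [← Measure.lintegral_compProd (f := fun p : EuclideanSpace ℝ A × EuclideanSpace ℝ ↥(Aᶜ) =>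
        ENNReal.ofReal (‖p.2 - 0‖ ^ 2)) (by fun_prop), hJ, lintegral_map (by fun_prop) hm]
      refine ne_top_of_le_ne_top (h2.integrable_norm_pow (by norm_num)).lintegral_lt_top.ne
        (lintegral_mono fun x => ENNReal.ofReal_le_ofReal ?_)
      have := norm_sub_sq_eq_restr A x 0
      have h0 : restr Aᶜ (0 : EuclideanSpace ℝ (Fin m)) = 0 := rfl
      rw [h0] at this
      simp only [sub_zero, id_eq] at this ⊢
      rw [this]
      exact le_add_of_nonneg_left (by positivity)
    filter_upwards [ae_lt_top (Measurable.lintegral_kernel_prod_right'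
      (f := fun p : EuclideanSpace ℝ A × EuclideanSpace ℝ ↥(Aᶜ) => ENNReal.ofReal (‖p.2 - 0‖ ^ 2))
      (by fun_prop)) hfin] with x hx
      using memLp_id_of_lintegral_lt_top hx
  -- A function of `X_A` is determined almost everywhere by its integrals over measurable sets;
  -- `setIntegral_condLawX` computes them for the conditional mean.
  have hcoord : ∀ j : ↥(Aᶜ), ∀ᵐ x ∂N, ∫ z, z j ∂(R x) = regL A π τ₁ x j := by
    intro j
    have hint : Integrable (fun p : EuclideanSpace ℝ A × EuclideanSpace ℝ ↥(Aᶜ) => p.2 j) (N ⊗ₘ R) := by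
      rw [hJ, integrable_map_measure (by fun_prop) hm.aemeasurable]
      exact (memLp_eval_of_memLp_id h2 (j : Fin m)).integrable (by norm_num)
    have hint' : Integrable (fun x => ∫ z, z j ∂(R x)) N := by
      refine ((Measure.integrable_compProd_iff hint.aestronglyMeasurable).1 hint).2.mono' ?_
        (ae_of_all _ fun x => norm_integral_le_integral_norm _)
      exact (StronglyMeasurable.integral_kernel_prod_right' (κ := R)
        (f := fun p : EuclideanSpace ℝ A × EuclideanSpace ℝ ↥(Aᶜ) => p.2 j)
        (by fun_prop)).aestronglyMeasurable
    refine Integrable.ae_eq_of_forall_setIntegral_eq _ _ hint'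
      (((EuclideanSpace.proj j : EuclideanSpace ℝ ↥(Aᶜ) →L[ℝ] ℝ).comp (regL A π τ₁)).integrable_comp
        (IsGaussian.integrable_id (μ := N))) fun s hs _ => ?_
    have e1 := Measure.setIntegral_compProd (μ := N) (κ := R) hs MeasurableSet.univ hint.integrableOn
    simp only [Measure.restrict_univ] at e1
    rw [← e1, hJ, setIntegral_map (hs.prod MeasurableSet.univ) (by fun_prop) hm.aemeasurable]
    have e2 : (fun x => (restr A x, restr Aᶜ x)) ⁻¹' (s ×ˢ (Set.univ : Set (EuclideanSpace ℝ ↥(Aᶜ)))) =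
        restr A ⁻¹' s := by ext; simp
    rw [e2]
    refine (setIntegral_condLawX hΘ_pd hπ hΘ_compact j hs).trans ?_
    rw [hN, ← map_restr_condLawX hΘ_pd hπ,
      setIntegral_map hs (by fun_prop) (measurable_restr A).aemeasurable]
    simp only [regL_apply]
    rfl
  filter_upwards [hmem, ae_all_iff.2 hcoord] with x hx hx'
  refine ⟨hx, ?_⟩
  ext j
  rw [← hx' j]
  exact ((EuclideanSpace.proj j : EuclideanSpace ℝ ↥(Aᶜ) →L[ℝ] ℝ).integral_comp_comm
    (hx.integrable (by norm_num))).symm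

/-- By the bias-variance identity the inner infimum is attained at the conditional mean, which is
the linear regression. -/
lemma deltaMinBayes_eq (hΘ_pd : ∀ τ ∈ Θ, τ.PosDef) (hπ : ∀ᵐ τ ∂π, τ ∈ atom A Θ τ₁)
    (hΘ_compact : IsCompact Θ) :
    deltaMinBayes A π = ∫⁻ x, ∫⁻ z, ENNReal.ofReal (‖z - regL A π τ₁ x‖ ^ 2)
      ∂(condDistrib (restr Aᶜ) (restr A) (condLawX π) x) ∂(multivariateGaussian 0 τ₁) := by
  rw [deltaMinBayes, map_restr_condLawX hΘ_pd hπ]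
  refine lintegral_congr_ae ?_
  filter_upwards [condDistrib_condLawX_mean hΘ_pd hπ hΘ_compact] with x hx
  refine le_antisymm (iInf_le _ _) (le_iInf fun y => ?_)
  rw [lintegral_norm_sub_sq_eq hx.1 y, hx.2]
  exact le_self_add

/-- The distortion of a channel driven by `X_A`: the error in representing `X_A` and its regression,
plus the minimal error `deltaMinBayes`. -/
lemma lintegral_distortion_eq (hΘ_pd : ∀ τ ∈ Θ, τ.PosDef) (hπ : ∀ᵐ τ ∂π, τ ∈ atom A Θ τ₁)
    (hΘ_compact : IsCompact Θ) (W : Kernel (EuclideanSpace ℝ A) (EuclideanSpace ℝ (Fin m)))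
    [IsMarkovKernel W] :
    ∫⁻ p, ENNReal.ofReal (‖p.1 - p.2‖ ^ 2)
        ∂(condLawX π ⊗ₘ W.comap (restr A) (measurable_restr A)) =
      ∫⁻ p, ENNReal.ofReal (‖p.1 - restr A p.2‖ ^ 2 + ‖regL A π τ₁ p.1 - restr Aᶜ p.2‖ ^ 2)
        ∂(multivariateGaussian 0 τ₁ ⊗ₘ W) + deltaMinBayes A π := by
  rw [deltaMinBayes_eq hΘ_pd hπ hΘ_compact]
  set R := condDistrib (restr Aᶜ) (restr A) (condLawX π) with hR
  set N := multivariateGaussian (0 : EuclideanSpace ℝ A) τ₁ with hN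
  have hJ : N ⊗ₘ R = (condLawX π).map fun x => (restr A x, restr Aᶜ x) :=
    compProd_condDistrib_condLawX hΘ_pd hπ
  have hm : Measurable fun x => (restr A x, restr Aᶜ x) :=
    (measurable_restr A).prodMk (measurable_restr Aᶜ)
  have hrA := measurable_restr A
  have hrc := measurable_restr Aᶜ
  let F : (EuclideanSpace ℝ A × EuclideanSpace ℝ ↥(Aᶜ)) × EuclideanSpace ℝ (Fin m) → ℝ≥0∞ := fun q =>
    ENNReal.ofReal (‖q.1.1 - restr A q.2‖ ^ 2) + ENNReal.ofReal (‖q.1.2 - restr Aᶜ q.2‖ ^ 2)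
  have hF : Measurable F := by fun_prop
  have e1 : ∫⁻ p, ENNReal.ofReal (‖p.1 - p.2‖ ^ 2)
        ∂(condLawX π ⊗ₘ W.comap (restr A) (measurable_restr A)) =
      ∫⁻ x, ∫⁻ z, ∫⁻ y, F ((x, z), y) ∂(W x) ∂(R x) ∂N := by
    have hG : Measurable fun p : EuclideanSpace ℝ A × EuclideanSpace ℝ ↥(Aᶜ) =>
        ∫⁻ y, F (p, y) ∂(W p.1) := by
      have := Measurable.lintegral_kernel_prod_right'
        (κ := W.comap (Prod.fst : EuclideanSpace ℝ A × EuclideanSpace ℝ ↥(Aᶜ) → _) measurable_fst) hF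
      exact this
    rw [Measure.lintegral_compProd (by fun_prop),
      ← Measure.lintegral_compProd (f := fun p => ∫⁻ y, F (p, y) ∂(W p.1)) hG, hJ,
      lintegral_map hG hm]
    refine lintegral_congr fun x => ?_
    rw [Kernel.comap_apply]
    refine lintegral_congr fun y => ?_
    simp only [F]
    rw [← ENNReal.ofReal_add (by positivity) (by positivity), ← norm_sub_sq_eq_restr]
  have e2 : ∀ᵐ x ∂N, ∫⁻ z, ∫⁻ y, F ((x, z), y) ∂(W x) ∂(R x) =
      ∫⁻ y, ENNReal.ofReal (‖x - restr A y‖ ^ 2 + ‖regL A π τ₁ x - restr Aᶜ y‖ ^ 2) ∂(W x) +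
        ∫⁻ z, ENNReal.ofReal (‖z - regL A π τ₁ x‖ ^ 2) ∂(R x) := by
    filter_upwards [condDistrib_condLawX_mean hΘ_pd hπ hΘ_compact] with x hx
    -- Given `X_A = x`, `X_{A^c}` and `Y_M` are independent. Integrating over `z` first splits off a
    -- conditional variance free of `y`.
    rw [lintegral_lintegral_swap (by fun_prop)]
    have e3 : ∀ y, ∫⁻ z, F ((x, z), y) ∂(R x) =
        ENNReal.ofReal (‖x - restr A y‖ ^ 2 + ‖regL A π τ₁ x - restr Aᶜ y‖ ^ 2) +
          ∫⁻ z, ENNReal.ofReal (‖z - regL A π τ₁ x‖ ^ 2) ∂(R x) := by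
      intro y
      simp only [F]
      rw [lintegral_add_left (by fun_prop), lintegral_norm_sub_sq_eq hx.1, hx.2,
        ENNReal.ofReal_add (by positivity) (by positivity), lintegral_const]
      simp only [measure_univ, mul_one]
      ring
    simp only [e3]
    rw [lintegral_add_right _ measurable_const, lintegral_const]
    simp
  rw [e1, lintegral_congr_ae e2, lintegral_add_left, Measure.lintegral_compProd (by fun_prop)]
  exact Measurable.lintegral_kernel_prod_right'
    (f := fun p : EuclideanSpace ℝ A × EuclideanSpace ℝ (Fin m) =>
      ENNReal.ofReal (‖p.1 - restr A p.2‖ ^ 2 + ‖regL A π τ₁ p.1 - restr Aᶜ p.2‖ ^ 2)) (by fun_prop)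

end Bayes

/-! ### Mutual information -/

section MutualInfo

variable {Ω E F G : Type*} [MeasurableSpace Ω] [MeasurableSpace E] [MeasurableSpace F]
  [MeasurableSpace G]

lemma mutualInfo_map {P : Measure Ω} {U : Ω → E} {V : Ω → F} (hU : Measurable U)
    (hV : Measurable V) :
    mutualInfo P U V = mutualInfo (P.map fun ω => (U ω, V ω)) Prod.fst Prod.snd := by
  rw [mutualInfo, mutualInfo, Measure.map_map measurable_fst (hU.prodMk hV),
    Measure.map_map measurable_snd (hU.prodMk hV), Measure.map_map (by fun_prop) (hU.prodMk hV)]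
  rfl

lemma jointAC_map {P : Measure Ω} {U : Ω → E} {V : Ω → F} (hU : Measurable U)
    (hV : Measurable V) :
    JointAC P U V ↔ JointAC (P.map fun ω => (U ω, V ω)) Prod.fst Prod.snd := by
  rw [JointAC, JointAC, Measure.map_map measurable_fst (hU.prodMk hV),
    Measure.map_map measurable_snd (hU.prodMk hV), Measure.map_map (by fun_prop) (hU.prodMk hV)]
  rfl

lemma mutualInfo_fst_snd (Q : Measure (E × F)) :
    mutualInfo Q Prod.fst Prod.snd =
      klDiv Q ((Q.map Prod.fst).prod (Q.map Prod.snd)) / ENNReal.ofReal (Real.log 2) := by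
  rw [mutualInfo]
  congr 2
  exact Measure.map_id

lemma jointAC_fst_snd (Q : Measure (E × F)) :
    JointAC Q Prod.fst Prod.snd ↔ Q ≪ (Q.map Prod.fst).prod (Q.map Prod.snd) := by
  rw [JointAC]
  have : (Q.map fun ω => (ω.1, ω.2)) = Q := Measure.map_id
  rw [this]

lemma map_prodMap_id_prod {Q : Measure (E × F)} [IsFiniteMeasure Q] {f : F → G} (hf : Measurable f) :
    ((Q.map (Prod.map id f)).map Prod.fst).prod ((Q.map (Prod.map id f)).map Prod.snd) =
      ((Q.map Prod.fst).prod (Q.map Prod.snd)).map (Prod.map id f) := by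
  rw [Measure.map_map measurable_fst (by fun_prop), Measure.map_map measurable_snd (by fun_prop),
    ← Measure.map_prod_map _ _ measurable_id hf, Measure.map_id, Measure.map_map hf measurable_snd]
  rfl

/-- Data processing: the map `id × f` carries the joint law and the product of its marginals to the
corresponding pair, and divergence does not grow under a map. -/
lemma mutualInfo_map_le {Q : Measure (E × F)} [IsFiniteMeasure Q] {f : F → G} (hf : Measurable f) :
    mutualInfo (Q.map (Prod.map id f)) Prod.fst Prod.snd ≤ mutualInfo Q Prod.fst Prod.snd := by
  rw [mutualInfo_fst_snd, mutualInfo_fst_snd, map_prodMap_id_prod hf]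
  gcongr
  exact klDiv_map_le _ _ (by fun_prop)

lemma JointAC.map_snd {Q : Measure (E × F)} [IsFiniteMeasure Q] {f : F → G} (hf : Measurable f)
    (h : JointAC Q Prod.fst Prod.snd) : JointAC (Q.map (Prod.map id f)) Prod.fst Prod.snd := by
  rw [jointAC_fst_snd] at h ⊢
  rw [map_prodMap_id_prod hf]
  exact h.map (by fun_prop)

lemma map_fst_prodMap_id (Q : Measure (E × F)) {f : F → G} (hf : Measurable f) :
    (Q.map (Prod.map id f)).map Prod.fst = Q.map Prod.fst := by
  rw [Measure.map_map measurable_fst (by fun_prop)]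
  rfl

/-- A channel that reads its input only through `f` sees only the image law; with `f = restr A` this
passes from `X_M` to `X_A`. -/
lemma map_comap_compProd (μ : Measure E) [SFinite μ] {f : E → F} (hf : Measurable f)
    (W : Kernel F G) [IsSFiniteKernel W] :
    (μ ⊗ₘ W.comap f hf).map (Prod.map f id) = μ.map f ⊗ₘ W := by
  refine Measure.ext_of_lintegral _ fun g hg => ?_
  rw [lintegral_map hg (by fun_prop), Measure.lintegral_compProd (by fun_prop),
    Measure.lintegral_compProd hg, lintegral_map _ hf]
  · rfl
  · exact Measurable.lintegral_kernel_prod_right' hg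

end MutualInfo

/-! ### Reduction of the Bayesian problem -/

/-- Weighted projection onto the graph of a linear map. -/
lemma exists_graph_projection {E F : Type*} [NormedAddCommGroup E] [InnerProductSpace ℝ E]
    [FiniteDimensional ℝ E] [NormedAddCommGroup F] [InnerProductSpace ℝ F] [FiniteDimensional ℝ F]
    (L : E →L[ℝ] F) :
    ∃ f : E × F → E, Continuous f ∧ ∀ x y z,
      ‖x - f (y, z)‖ ^ 2 + ‖L (x - f (y, z))‖ ^ 2 ≤ ‖x - y‖ ^ 2 + ‖L x - z‖ ^ 2 := by
  have := FiniteDimensional.complete ℝ E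
  have := FiniteDimensional.complete ℝ F
  -- The normal operator of least squares on the graph of `L`: solving `T f = y + L* z` gives the
  -- first coordinate of the orthogonal projection of `(y, z)`.
  let T : E →ₗ[ℝ] E := LinearMap.id + ((L.adjoint.comp L : E →L[ℝ] E) : E →ₗ[ℝ] E)
  have hT : ∀ x, T x = x + L.adjoint (L x) := fun _ => rfl
  have hinj : Function.Injective T := by
    rw [← LinearMap.ker_eq_bot, LinearMap.ker_eq_bot']
    intro x hx
    have h : inner ℝ x (T x) = ‖x‖ ^ 2 + ‖L x‖ ^ 2 := by
      rw [hT, inner_add_right, ContinuousLinearMap.adjoint_inner_right,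
        real_inner_self_eq_norm_sq, real_inner_self_eq_norm_sq]
    rw [hx, inner_zero_right] at h
    have : ‖x‖ ^ 2 = 0 := by nlinarith [sq_nonneg ‖x‖, sq_nonneg ‖L x‖]
    simpa using this
  let e := LinearEquiv.ofInjectiveEndo T hinj
  have he : ∀ x, T (e.symm x) = x := fun x => e.apply_symm_apply x
  refine ⟨fun p => e.symm (p.1 + L.adjoint p.2), ?_, fun x y z => ?_⟩
  · have : Continuous e.symm := LinearMap.continuous_of_finiteDimensional e.symm.toLinearMap
    fun_prop
  simp only
  set f := e.symm (y + L.adjoint z) with hf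
  have hfe : f + L.adjoint (L f) = y + L.adjoint z := by rw [← hT]; exact he _
  have e1 : x - y = (x - f) + (f - y) := by abel
  have e2 : L x - z = L (x - f) + (L f - z) := by rw [map_sub]; abel
  -- The residual is orthogonal to the graph, so Pythagoras applies and two squares are dropped.
  have e3 : inner ℝ (x - f) (f - y) + inner ℝ (L (x - f)) (L f - z) = 0 := by
    rw [← ContinuousLinearMap.adjoint_inner_right, ← inner_add_right, map_sub]
    have : f - y + (L.adjoint (L f) - L.adjoint z) = 0 := by
      rw [add_sub_assoc', sub_add_eq_add_sub, hfe]; abel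
    rw [this, inner_zero_right]
  rw [e1, e2, norm_add_sq_real, norm_add_sq_real]
  nlinarith [sq_nonneg ‖f - y‖, sq_nonneg ‖L f - z‖]

section Bayes

variable {Θ : Set (Matrix (Fin m) (Fin m) ℝ)} {A : Finset (Fin m)} {τ₁ : Matrix A A ℝ}
  {π : Measure (Matrix (Fin m) (Fin m) ℝ)}

/-- Symmetry of `τ₁⁻¹` gives `G = 1 + B Bᵀ` with `B = regCoeff A π τ₁`: the weight counts the error
on `A` together with its image under the regression. -/
lemma weightedDist_eq (hτ₁ : τ₁.PosDef) (x y : EuclideanSpace ℝ A) :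
    weightedDist A π τ₁ x y = ‖x - y‖ ^ 2 + ‖regL A π τ₁ (x - y)‖ ^ 2 := by
  have hs : (τ₁⁻¹)ᵀ = τ₁⁻¹ := by
    rw [Matrix.transpose_nonsing_inv]
    congr 1
    simpa using hτ₁.isHermitian.eq
  have hG : weightMatrix A π τ₁ = 1 + regCoeff A π τ₁ * (regCoeff A π τ₁)ᵀ := by
    rw [weightMatrix, regCoeff, Matrix.transpose_mul, hs]
    simp only [Matrix.mul_assoc]
  have hL : (regL A π τ₁ (x - y)).ofLp = (regCoeff A π τ₁)ᵀ *ᵥ (x - y).ofLp := by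
    ext j
    rw [regL_apply]
    rfl
  have hn : ∀ {κ : Type} [Fintype κ] (u : EuclideanSpace ℝ κ), ‖u‖ ^ 2 = u.ofLp ⬝ᵥ u.ofLp := by
    intro κ _ u
    rw [EuclideanSpace.real_norm_sq_eq]
    simp [dotProduct, sq]
  rw [weightedDist, hG, Matrix.add_mulVec, Matrix.one_mulVec, dotProduct_add, hn, hn, hL,
    ← Matrix.mulVec_mulVec, Matrix.dotProduct_mulVec, ← Matrix.mulVec_transpose]

variable [IsProbabilityMeasure π]

lemma measurable_subCov (A : Finset (Fin m)) : Measurable (subCov A) := by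
  have : Measurable fun (τ : Fin m → Fin m → ℝ) (i j : A) => τ i j := by fun_prop
  exact this

/-- The joint law of `(X_M, Y_M)` under a Bayesian feasible law comes from a channel driven by
`X_A`. -/
lemma exists_kernel_of_markov (hπ : ∀ᵐ τ ∂π, τ ∈ atom A Θ τ₁)
    {P : Measure (Matrix (Fin m) (Fin m) ℝ × EuclideanSpace ℝ (Fin m) × EuclideanSpace ℝ (Fin m))}
    (h1 : P.map (fun ω => (ω.1, ω.2.1)) = π ⊗ₘ gaussianKernel (Fin m))
    (h2 : IsMarkovChain P (fun ω => (ω.1, ω.2.1)) (fun ω => (subCov A ω.1, restr A ω.2.1))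
      (fun ω => ω.2.2)) :
    ∃ W : Kernel (EuclideanSpace ℝ A) (EuclideanSpace ℝ (Fin m)), IsMarkovKernel W ∧
      P.map (fun ω => (ω.2.1, ω.2.2)) =
        condLawX π ⊗ₘ W.comap (restr A) (measurable_restr A) := by
  obtain ⟨K, hK, hP⟩ := h2
  have hsub := measurable_subCov A
  have hres := measurable_restr A
  -- Under `π` the value of `θ₁` is almost surely `τ₁`, so the Markov kernel matters only there.
  refine ⟨K.comap (fun x => (τ₁, x)) (by fun_prop), inferInstance,
    Measure.ext_of_lintegral _ fun g hg => ?_⟩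
  let j : Matrix (Fin m) (Fin m) ℝ × EuclideanSpace ℝ (Fin m) →
      (Matrix (Fin m) (Fin m) ℝ × EuclideanSpace ℝ (Fin m)) × (Matrix A A ℝ × EuclideanSpace ℝ A) :=
    fun u => (u, (subCov A u.1, restr A u.2))
  have hj : Measurable j := by fun_prop
  have e1 : P.map (fun ω => ((ω.1, ω.2.1), (subCov A ω.1, restr A ω.2.1))) =
      (π ⊗ₘ gaussianKernel (Fin m)).map j := by
    rw [← h1, Measure.map_map hj (by fun_prop)]
    rfl
  have e2 : P.map (fun ω => (ω.2.1, ω.2.2)) = (P.map fun ω => (((ω.1, ω.2.1),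
      (subCov A ω.1, restr A ω.2.1)), ω.2.2)).map fun q => (q.1.1.2, q.2) := by
    rw [Measure.map_map (by fun_prop) (by fun_prop)]
    rfl
  have hm1 : Measurable fun q : (Matrix (Fin m) (Fin m) ℝ × EuclideanSpace ℝ (Fin m)) ×
      (Matrix A A ℝ × EuclideanSpace ℝ A) => ∫⁻ y, g (q.1.2, y) ∂(K q.2) :=
    Measurable.lintegral_kernel_prod_right' (κ := K.comap Prod.snd measurable_snd)
      (f := fun p : ((Matrix (Fin m) (Fin m) ℝ × EuclideanSpace ℝ (Fin m)) ×
        (Matrix A A ℝ × EuclideanSpace ℝ A)) × EuclideanSpace ℝ (Fin m) => g (p.1.1.2, p.2))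
      (by fun_prop)
  have hm2 : Measurable fun x : EuclideanSpace ℝ (Fin m) => ∫⁻ y, g (x, y) ∂(K (τ₁, restr A x)) :=
    Measurable.lintegral_kernel_prod_right'
      (κ := K.comap (fun x : EuclideanSpace ℝ (Fin m) => (τ₁, restr A x)) (by fun_prop)) hg
  rw [e2, hP, e1, lintegral_map hg (by fun_prop), Measure.lintegral_compProd (by fun_prop),
    Measure.lintegral_compProd hg]
  simp only [Kernel.comap_apply]
  rw [lintegral_map hm1 hj, lintegral_condLawX hm2,
    Measure.lintegral_compProd (f := fun u => ∫⁻ y, g ((j u).1.2, y) ∂(K (j u).2)) (hm1.comp hj)]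
  refine lintegral_congr_ae ?_
  filter_upwards [hπ] with τ hτ
  refine lintegral_congr fun x => ?_
  simp only [j, hτ.2]

/-- A channel driven by `X_A` defines a joint law of `(θ, X_M, Y_M)`. -/
lemma exists_markov_of_kernel (A : Finset (Fin m)) (π : Measure (Matrix (Fin m) (Fin m) ℝ))
    [IsProbabilityMeasure π]
    (W : Kernel (EuclideanSpace ℝ A) (EuclideanSpace ℝ (Fin m))) [IsMarkovKernel W] :
    ∃ P : Measure (Matrix (Fin m) (Fin m) ℝ × EuclideanSpace ℝ (Fin m) × EuclideanSpace ℝ (Fin m)),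
      P.map (fun ω => (ω.1, ω.2.1)) = π ⊗ₘ gaussianKernel (Fin m) ∧
      IsMarkovChain P (fun ω => (ω.1, ω.2.1)) (fun ω => (subCov A ω.1, restr A ω.2.1))
        (fun ω => ω.2.2) ∧
      P.map (fun ω => (ω.2.1, ω.2.2)) =
        condLawX π ⊗ₘ W.comap (restr A) (measurable_restr A) := by
  have hsub := measurable_subCov A
  have hres := measurable_restr A
  let κ : Kernel (Matrix (Fin m) (Fin m) ℝ × EuclideanSpace ℝ (Fin m)) (EuclideanSpace ℝ (Fin m)) :=
    W.comap (fun u => restr A u.2) (by fun_prop)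
  let j : Matrix (Fin m) (Fin m) ℝ × EuclideanSpace ℝ (Fin m) →
      (Matrix (Fin m) (Fin m) ℝ × EuclideanSpace ℝ (Fin m)) × (Matrix A A ℝ × EuclideanSpace ℝ A) :=
    fun u => (u, (subCov A u.1, restr A u.2))
  have hj : Measurable j := by fun_prop
  have hfst : (((π ⊗ₘ gaussianKernel (Fin m)) ⊗ₘ κ).map fun q => (q.1.1, q.1.2, q.2)).map
      (fun ω => (ω.1, ω.2.1)) = π ⊗ₘ gaussianKernel (Fin m) := by
    rw [Measure.map_map (by fun_prop) (by fun_prop)]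
    exact Measure.fst_compProd _ _
  -- `(θ, X_M)` is drawn first, then `Y_M` from `W` at `X_A`; the Markov kernel ignores `θ₁`.
  refine ⟨((π ⊗ₘ gaussianKernel (Fin m)) ⊗ₘ κ).map fun q => (q.1.1, q.1.2, q.2), hfst,
    ⟨W.comap Prod.snd measurable_snd, inferInstance, ?_⟩, ?_⟩
  · have e : (((π ⊗ₘ gaussianKernel (Fin m)) ⊗ₘ κ).map fun q => (q.1.1, q.1.2, q.2)).map
        (fun ω => ((ω.1, ω.2.1), (subCov A ω.1, restr A ω.2.1))) =
        (π ⊗ₘ gaussianKernel (Fin m)).map j := by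
      rw [← hfst, Measure.map_map hj (by fun_prop), hfst]
      rfl
    rw [e, ← map_comap_compProd _ hj, Measure.map_map (by fun_prop) (by fun_prop)]
    rfl
  · rw [Measure.map_map (by fun_prop) (by fun_prop), condLawX]
    refine Measure.ext_of_lintegral _ fun g hg => ?_
    have hm2 : Measurable fun x : EuclideanSpace ℝ (Fin m) => ∫⁻ y, g (x, y) ∂(W (restr A x)) :=
      Measurable.lintegral_kernel_prod_right' (κ := W.comap (restr A) hres) hg
    rw [lintegral_map hg (by fun_prop), Measure.lintegral_compProd (by fun_prop),
      Measure.lintegral_compProd hg]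
    simp only [Kernel.comap_apply]
    rw [lintegral_map hm2 measurable_snd]
    rfl

lemma map_restr_pair {P : Measure (Matrix (Fin m) (Fin m) ℝ × EuclideanSpace ℝ (Fin m) ×
      EuclideanSpace ℝ (Fin m))} (hΘ_pd : ∀ τ ∈ Θ, τ.PosDef) (hπ : ∀ᵐ τ ∂π, τ ∈ atom A Θ τ₁)
    {W : Kernel (EuclideanSpace ℝ A) (EuclideanSpace ℝ (Fin m))} [IsMarkovKernel W]
    (hP : P.map (fun ω => (ω.2.1, ω.2.2)) =
        condLawX π ⊗ₘ W.comap (restr A) (measurable_restr A)) :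
    P.map (fun ω => (restr A ω.2.1, ω.2.2)) = multivariateGaussian 0 τ₁ ⊗ₘ W := by
  have hres := measurable_restr A
  rw [← map_restr_condLawX hΘ_pd hπ, ← map_comap_compProd _ hres, ← hP,
    Measure.map_map (by fun_prop) (by fun_prop)]
  rfl

/-- Objective and constraints of the Bayesian problem, in terms of the channel from `X_A`. -/
lemma bayes_iff_kernel {P : Measure (Matrix (Fin m) (Fin m) ℝ × EuclideanSpace ℝ (Fin m) ×
      EuclideanSpace ℝ (Fin m))} (hΘ_pd : ∀ τ ∈ Θ, τ.PosDef) (hΘ_compact : IsCompact Θ)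
    (hπ : ∀ᵐ τ ∂π, τ ∈ atom A Θ τ₁)
    {W : Kernel (EuclideanSpace ℝ A) (EuclideanSpace ℝ (Fin m))} [IsMarkovKernel W]
    (hP : P.map (fun ω => (ω.2.1, ω.2.2)) =
        condLawX π ⊗ₘ W.comap (restr A) (measurable_restr A)) {δ : ℝ}
    (hδ : deltaMinBayes A π < ENNReal.ofReal δ) :
    bayesInfo A P = mutualInfo (multivariateGaussian 0 τ₁ ⊗ₘ W) Prod.fst Prod.snd ∧
    (JointAC P (fun ω => restr A ω.2.1) (fun ω => ω.2.2) ↔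
      JointAC (multivariateGaussian 0 τ₁ ⊗ₘ W) Prod.fst Prod.snd) ∧
    (∫⁻ ω, ENNReal.ofReal (‖ω.2.1 - ω.2.2‖ ^ 2) ∂P ≤ ENNReal.ofReal δ ↔
      ∫⁻ p, ENNReal.ofReal (‖p.1 - restr A p.2‖ ^ 2 + ‖regL A π τ₁ p.1 - restr Aᶜ p.2‖ ^ 2)
        ∂(multivariateGaussian 0 τ₁ ⊗ₘ W) ≤ ENNReal.ofReal δ - deltaMinBayes A π) := by
  have hres := measurable_restr A
  have hpair := map_restr_pair hΘ_pd hπ hP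
  refine ⟨?_, ?_, ?_⟩
  · rw [bayesInfo, mutualInfo_map (by fun_prop) (by fun_prop), hpair]
  · rw [jointAC_map (by fun_prop) (by fun_prop), hpair]
  · have e : ∫⁻ ω, ENNReal.ofReal (‖ω.2.1 - ω.2.2‖ ^ 2) ∂P = ∫⁻ p, ENNReal.ofReal (‖p.1 - p.2‖ ^ 2)
        ∂(P.map fun ω => (ω.2.1, ω.2.2)) := by
      rw [lintegral_map (by fun_prop) (by fun_prop)]
    rw [e, hP, lintegral_distortion_eq hΘ_pd hπ hΘ_compact]
    exact (ENNReal.le_sub_iff_add_le_right hδ.ne_top hδ.le).symm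

/-- Everything is compared with a minimizer `Q₀` of the reduced problem. Projection onto the graph
of the regression sends a feasible law to a reduced one, and completing `Y_A` by its regression
sends `Q₀` to a feasible law; neither step increases information. -/
theorem bayes_isLeast (hΘ_pd : ∀ τ ∈ Θ, τ.PosDef) (hΘ_compact : IsCompact Θ)
    (hτ₁ : τ₁.PosDef) (hπ : ∀ᵐ τ ∂π, τ ∈ atom A Θ τ₁) {δ : ℝ}
    (hδ : deltaMinBayes A π < ENNReal.ofReal δ) :
    IsLeast ((fun P => bayesInfo A P) '' bayesFeasible A π δ) (rhoBayes A π δ) ∧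
      IsLeast ((fun Q => mutualInfo Q Prod.fst Prod.snd) '' bayesReduced A π τ₁ δ)
        (rhoBayes A π δ) := by
  have hres := measurable_restr A
  have hresc := measurable_restr Aᶜ
  have hglue := measurable_glue A
  set L := regL A π τ₁ with hL
  set N := multivariateGaussian (0 : EuclideanSpace ℝ A) τ₁ with hN
  have hdw : ∀ p : EuclideanSpace ℝ A × EuclideanSpace ℝ A,
      weightedDist A π τ₁ p.1 p.2 = ‖p.1 - p.2‖ ^ 2 + ‖L (p.1 - p.2)‖ ^ 2 :=
    fun p => weightedDist_eq hτ₁ p.1 p.2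
  have hdc : Continuous fun p : EuclideanSpace ℝ A × EuclideanSpace ℝ A =>
      weightedDist A π τ₁ p.1 p.2 := by
    simp only [hdw]
    fun_prop
  -- The weighted distortion lies between `‖x - y‖²` and `(1 + ‖L‖²)‖x - y‖²`. Positivity of `D` is
  -- the strict inequality on `δ`.
  obtain ⟨Q₀, hQ₀1, hQ₀2, hQ₀3, hQ₀4⟩ := exists_min_klDiv N IsGaussian.memLp_two_id hdc
    (fun p => by rw [hdw]; exact le_add_of_nonneg_right (by positivity))
    (C := 1 + ‖L‖ ^ 2) (fun p => by
      rw [hdw, add_mul, one_mul, ← mul_pow]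
      gcongr
      exact L.le_opNorm _)
    (D := ENNReal.ofReal δ - deltaMinBayes A π) (tsub_pos_of_lt hδ).ne'
    (ne_top_of_le_ne_top ENNReal.ofReal_ne_top tsub_le_self)
  have hQ₀mem : Q₀ ∈ bayesReduced A π τ₁ δ := by
    refine ⟨hQ₀1, ?_, hQ₀2⟩
    rw [jointAC_fst_snd, hQ₀1]
    exact (klDiv_ne_top_iff.1 hQ₀3).1
  have hmin : ∀ Q ∈ bayesReduced A π τ₁ δ,
      mutualInfo Q₀ Prod.fst Prod.snd ≤ mutualInfo Q Prod.fst Prod.snd := by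
    rintro Q ⟨h1, -, h3⟩
    rw [mutualInfo_fst_snd, mutualInfo_fst_snd, hQ₀1, h1]
    gcongr
    exact hQ₀4 Q h1 h3
  have hlower : ∀ P ∈ bayesFeasible A π δ, ∃ Q ∈ bayesReduced A π τ₁ δ,
      mutualInfo Q Prod.fst Prod.snd ≤ bayesInfo A P := by
    rintro P ⟨h1, h2, h3, h4⟩
    obtain ⟨W, hW, hPW⟩ := exists_kernel_of_markov hπ h1 h2
    obtain ⟨i1, i2, i3⟩ := bayes_iff_kernel hΘ_pd hΘ_compact hπ hPW hδ
    obtain ⟨f, hf, hfL⟩ := exists_graph_projection L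
    let φ : EuclideanSpace ℝ (Fin m) → EuclideanSpace ℝ A := fun y => f (restr A y, restr Aᶜ y)
    have hφ : Measurable φ := hf.measurable.comp (by fun_prop)
    refine ⟨(N ⊗ₘ W).map (Prod.map id φ), ⟨?_, (i2.1 h3).map_snd hφ, ?_⟩, ?_⟩
    · rw [map_fst_prodMap_id _ hφ]
      exact Measure.fst_compProd _ _
    · rw [lintegral_map (by have := hdc.measurable; fun_prop) (by fun_prop)]
      refine le_trans (lintegral_mono fun p => ENNReal.ofReal_le_ofReal ?_) (i3.1 h4)
      rw [hdw]
      exact hfL _ _ _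
    · rw [i1]
      exact mutualInfo_map_le hφ
  have hupper : ∃ P ∈ bayesFeasible A π δ, bayesInfo A P ≤ mutualInfo Q₀ Prod.fst Prod.snd := by
    have : IsProbabilityMeasure Q₀ := by
      constructor
      have := congrArg (fun ν : Measure (EuclideanSpace ℝ A) => ν Set.univ) hQ₀1
      simpa [Measure.map_apply measurable_fst MeasurableSet.univ] using this
    -- With `Y_{A^c} = L Y_A` the regression error is `L (X_A - Y_A)`, so the distortion is exactly
    -- the weighted one.
    let ψ : EuclideanSpace ℝ A → EuclideanSpace ℝ (Fin m) := fun y => glue A (y, L y)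
    have hψ : Measurable ψ := by fun_prop
    have : IsMarkovKernel (Q₀.condKernel.map ψ) := Kernel.IsMarkovKernel.map _ hψ
    have hQW : N ⊗ₘ (Q₀.condKernel.map ψ) = Q₀.map (Prod.map id ψ) := by
      conv_rhs => rw [← Q₀.disintegrate Q₀.condKernel]
      rw [← Measure.compProd_map hψ, Measure.fst, hQ₀1]
    obtain ⟨P, h1, h2, hPW⟩ := exists_markov_of_kernel A π (Q₀.condKernel.map ψ)
    obtain ⟨i1, i2, i3⟩ := bayes_iff_kernel hΘ_pd hΘ_compact hπ hPW hδ
    refine ⟨P, ⟨h1, h2, i2.2 ?_, i3.2 ?_⟩, ?_⟩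
    · rw [hQW]
      exact hQ₀mem.2.1.map_snd hψ
    · rw [hQW, lintegral_map (by fun_prop) (by fun_prop)]
      refine le_trans (le_of_eq (lintegral_congr fun p => ?_)) hQ₀2
      simp only [Prod.map, id, ψ, restr_glue, restr_compl_glue, hdw, map_sub, hL]
    · rw [i1, hQW]
      exact mutualInfo_map_le hψ
  obtain ⟨P₀, hP₀, hP₀le⟩ := hupper
  have hrho : rhoBayes A π δ = mutualInfo Q₀ Prod.fst Prod.snd := by
    refine le_antisymm ((iInf₂_le P₀ hP₀).trans hP₀le) (le_iInf₂ fun P hP => ?_)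
    obtain ⟨Q, hQ, hQP⟩ := hlower P hP
    exact (hmin Q hQ).trans hQP
  refine ⟨⟨⟨P₀, hP₀, le_antisymm (hP₀le.trans hrho.ge) (iInf₂_le P₀ hP₀)⟩, ?_⟩,
    ⟨⟨Q₀, hQ₀mem, hrho.symm⟩, ?_⟩⟩
  · rintro _ ⟨P, hP, rfl⟩
    exact iInf₂_le P hP
  · rintro _ ⟨Q, hQ, rfl⟩
    rw [hrho]
    exact hmin Q hQ

end Bayes

/-! ### Cascades do not increase information -/

section Cascade

variable {A : Finset (Fin m)}

instance {W : Kernel (EuclideanSpace ℝ A) (EuclideanSpace ℝ A)}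
    {V : Kernel (EuclideanSpace ℝ A) (EuclideanSpace ℝ ↥(Aᶜ))} [IsMarkovKernel W]
    [IsMarkovKernel V] : IsMarkovKernel (cascade A W V) :=
  Kernel.IsMarkovKernel.map _ (measurable_glue A)

lemma lintegral_cascade (W : Kernel (EuclideanSpace ℝ A) (EuclideanSpace ℝ A))
    (V : Kernel (EuclideanSpace ℝ A) (EuclideanSpace ℝ ↥(Aᶜ))) [IsMarkovKernel W]
    [IsMarkovKernel V] (x : EuclideanSpace ℝ A) {g : EuclideanSpace ℝ (Fin m) → ℝ≥0∞}
    (hg : Measurable g) :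
    ∫⁻ w, g w ∂(cascade A W V x) = ∫⁻ y, ∫⁻ z, g (glue A (y, z)) ∂(V y) ∂(W x) := by
  have hglue := measurable_glue A
  rw [cascade, Kernel.map_apply _ hglue, lintegral_map hg hglue,
    Kernel.lintegral_compProd _ _ _ (by fun_prop)]
  rfl

lemma compProd_cascade (μ : Measure (EuclideanSpace ℝ A)) [IsProbabilityMeasure μ]
    (W : Kernel (EuclideanSpace ℝ A) (EuclideanSpace ℝ A))
    (V : Kernel (EuclideanSpace ℝ A) (EuclideanSpace ℝ ↥(Aᶜ))) [IsMarkovKernel W]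
    [IsMarkovKernel V] :
    μ ⊗ₘ cascade A W V = ((μ ⊗ₘ W) ⊗ₘ V.comap Prod.snd measurable_snd).map
      fun q => (q.1.1, glue A (q.1.2, q.2)) := by
  have hglue := measurable_glue A
  refine Measure.ext_of_lintegral _ fun g hg => ?_
  have h1 : Measurable fun p : EuclideanSpace ℝ A × EuclideanSpace ℝ A =>
      ∫⁻ z, g (p.1, glue A (p.2, z)) ∂(V p.2) :=
    Measurable.lintegral_kernel_prod_right' (κ := V.comap Prod.snd measurable_snd)
      (f := fun q : (EuclideanSpace ℝ A × EuclideanSpace ℝ A) × EuclideanSpace ℝ ↥(Aᶜ) =>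
        g (q.1.1, glue A (q.1.2, q.2))) (by fun_prop)
  rw [Measure.lintegral_compProd hg, lintegral_map hg (by fun_prop),
    Measure.lintegral_compProd (by fun_prop)]
  simp only [Kernel.comap_apply]
  rw [Measure.lintegral_compProd h1]
  exact lintegral_congr fun x => lintegral_cascade W V x (by fun_prop)

/-- `V` reads only the second coordinate, so the first stays independent of the glued vector. -/
lemma prod_compProd_map_glue (μ ν : Measure (EuclideanSpace ℝ A)) [IsProbabilityMeasure μ]
    [IsProbabilityMeasure ν] (V : Kernel (EuclideanSpace ℝ A) (EuclideanSpace ℝ ↥(Aᶜ)))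
    [IsMarkovKernel V] :
    ((μ.prod ν) ⊗ₘ V.comap Prod.snd measurable_snd).map (fun q => (q.1.1, glue A (q.1.2, q.2))) =
      μ.prod ((ν ⊗ₘ V).map (glue A)) := by
  have hglue := measurable_glue A
  have : IsProbabilityMeasure ((ν ⊗ₘ V).map (glue A)) :=
    Measure.isProbabilityMeasure_map hglue.aemeasurable
  refine Measure.ext_of_lintegral _ fun g hg => ?_
  have h1 : Measurable fun p : EuclideanSpace ℝ A × EuclideanSpace ℝ A =>
      ∫⁻ z, g (p.1, glue A (p.2, z)) ∂(V p.2) :=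
    Measurable.lintegral_kernel_prod_right' (κ := V.comap Prod.snd measurable_snd)
      (f := fun q : (EuclideanSpace ℝ A × EuclideanSpace ℝ A) × EuclideanSpace ℝ ↥(Aᶜ) =>
        g (q.1.1, glue A (q.1.2, q.2))) (by fun_prop)
  rw [lintegral_map hg (by fun_prop), Measure.lintegral_compProd (by fun_prop)]
  simp only [Kernel.comap_apply]
  rw [lintegral_prod _ h1.aemeasurable, lintegral_prod _ hg.aemeasurable]
  refine lintegral_congr fun x => ?_
  rw [lintegral_map (by fun_prop) hglue, Measure.lintegral_compProd (by fun_prop)]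

lemma map_snd_compProd_cascade (μ : Measure (EuclideanSpace ℝ A)) [IsProbabilityMeasure μ]
    (W : Kernel (EuclideanSpace ℝ A) (EuclideanSpace ℝ A))
    (V : Kernel (EuclideanSpace ℝ A) (EuclideanSpace ℝ ↥(Aᶜ))) [IsMarkovKernel W]
    [IsMarkovKernel V] :
    (μ ⊗ₘ cascade A W V).map Prod.snd = (((μ ⊗ₘ W).map Prod.snd) ⊗ₘ V).map (glue A) := by
  have hglue := measurable_glue A
  rw [compProd_cascade, ← map_comap_compProd _ measurable_snd, Measure.map_map hglue (by fun_prop),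
    Measure.map_map (by fun_prop) (by fun_prop)]
  rfl

lemma map_fst_compProd {E F : Type*} [MeasurableSpace E] [MeasurableSpace F] (μ : Measure E)
    [SFinite μ] (W : Kernel E F) [IsMarkovKernel W] : (μ ⊗ₘ W).map Prod.fst = μ :=
  Measure.fst_compProd μ W

lemma isProbabilityMeasure_map_snd {E F : Type*} [MeasurableSpace E] [MeasurableSpace F]
    (Q : Measure (E × F)) [IsProbabilityMeasure Q] : IsProbabilityMeasure (Q.map Prod.snd) :=
  Measure.isProbabilityMeasure_map measurable_snd.aemeasurable

/-- Appending the same kernel `V` to the joint law and to the product law leaves their divergence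
unchanged, and regrouping coordinates cannot increase it. -/
lemma mutualInfo_cascade_le (μ : Measure (EuclideanSpace ℝ A)) [IsProbabilityMeasure μ]
    (W : Kernel (EuclideanSpace ℝ A) (EuclideanSpace ℝ A))
    (V : Kernel (EuclideanSpace ℝ A) (EuclideanSpace ℝ ↥(Aᶜ))) [IsMarkovKernel W]
    [IsMarkovKernel V] :
    mutualInfo (μ ⊗ₘ cascade A W V) Prod.fst Prod.snd ≤ mutualInfo (μ ⊗ₘ W) Prod.fst Prod.snd := by
  have hglue := measurable_glue A
  have := isProbabilityMeasure_map_snd (μ ⊗ₘ W)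
  rw [mutualInfo_fst_snd, mutualInfo_fst_snd, map_fst_compProd, map_fst_compProd,
    map_snd_compProd_cascade, ← prod_compProd_map_glue, compProd_cascade]
  gcongr
  exact (klDiv_map_le _ _ (by fun_prop)).trans (klDiv_compProd_left _ _ _).le

lemma JointAC.cascade {μ : Measure (EuclideanSpace ℝ A)} [IsProbabilityMeasure μ]
    {W : Kernel (EuclideanSpace ℝ A) (EuclideanSpace ℝ A)}
    (V : Kernel (EuclideanSpace ℝ A) (EuclideanSpace ℝ ↥(Aᶜ))) [IsMarkovKernel W]
    [IsMarkovKernel V] (h : JointAC (μ ⊗ₘ W) Prod.fst Prod.snd) :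
    JointAC (μ ⊗ₘ cascade A W V) Prod.fst Prod.snd := by
  have hglue := measurable_glue A
  have := isProbabilityMeasure_map_snd (μ ⊗ₘ W)
  rw [jointAC_fst_snd, map_fst_compProd] at h ⊢
  rw [map_snd_compProd_cascade, ← prod_compProd_map_glue, compProd_cascade]
  exact (h.compProd_left _).map (by fun_prop)

end Cascade

/-! ### Encoding a vector in one real coordinate -/

/-- Up to an error `ε`, the block `y_A` can carry the whole block `y_{A^c}`. -/
lemma exists_encoding {A : Finset (Fin m)} (hA : A.Nonempty) {ε : ℝ} (hε : 0 < ε) :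
    ∃ (enc : EuclideanSpace ℝ (Fin m) → EuclideanSpace ℝ A)
      (dec : EuclideanSpace ℝ A → EuclideanSpace ℝ ↥(Aᶜ)), Measurable enc ∧ Measurable dec ∧
      ∀ y, dec (enc y) = restr Aᶜ y ∧ ‖restr A y - enc y‖ ≤ ε := by
  obtain ⟨a, ha⟩ := hA
  let i : A := ⟨a, ha⟩
  -- A measurable embedding into `ℝ` puts the whole block in one real number; `d` is a measurable
  -- left inverse.
  have hu := measurableEmbedding_embeddingReal (EuclideanSpace ℝ ↥(Aᶜ))
  obtain ⟨d, hd, hdu⟩ := hu.exists_measurable_extend measurable_id fun _ => inferInstance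
  -- `v` squashes the line into `(0, 1)` and `w` undoes it, so that a real number can serve as a
  -- fractional part.
  let v : ℝ → ℝ := fun t => (1 + t / (1 + |t|)) / 2
  let w : ℝ → ℝ := fun r => (2 * r - 1) / (1 - |2 * r - 1|)
  have hv : Measurable v := by fun_prop
  have hw : Measurable w := by fun_prop
  have habs : ∀ t : ℝ, |t / (1 + |t|)| < 1 := fun t => by
    rw [abs_div, abs_of_pos (show 0 < 1 + |t| by positivity), div_lt_one (by positivity)]
    linarith
  have hv0 : ∀ t, 0 ≤ v t := fun t => by
    have := (abs_lt.1 (habs t)).1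
    simp only [v]; linarith
  have hv1 : ∀ t, v t < 1 := fun t => by
    have := (abs_lt.1 (habs t)).2
    simp only [v]; linarith
  have hwv : ∀ t, w (v t) = t := fun t => by
    have e : 2 * v t - 1 = t / (1 + |t|) := by simp only [v]; ring
    have hpos : 0 < 1 + |t| := by positivity
    simp only [w, e]
    rw [abs_div, abs_of_pos hpos]
    field_simp
    ring_nf
  let φ : EuclideanSpace ℝ (Fin m) → ℝ := fun y => v (embeddingReal _ (restr Aᶜ y))
  have hres := measurable_restr A
  have hresc := measurable_restr Aᶜ
  have hum := hu.measurable
  have hφ : Measurable φ := by fun_prop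
  -- In units of `ε`, the integer part of `y a` is kept and its fractional part is replaced by the
  -- code `φ y`. This moves `y a` by at most `ε`, and `Int.fract` recovers the code.
  let r : EuclideanSpace ℝ (Fin m) → ℝ := fun y => ε * (⌊y a / ε⌋ + φ y)
  have hr : Measurable r := by
    have : Measurable fun y : EuclideanSpace ℝ (Fin m) => ((⌊y a / ε⌋ : ℤ) : ℝ) :=
      measurable_from_top.comp (Int.measurable_floor.comp (by fun_prop))
    fun_prop
  refine ⟨fun y => restr A y - EuclideanSpace.single i (y a - r y),
    fun x => d (w (Int.fract (x i / ε))), ?_, ?_, fun y => ⟨?_, ?_⟩⟩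
  · have : Measurable fun t : ℝ => (EuclideanSpace.single i t : EuclideanSpace ℝ A) := by
      have hc : Continuous fun t : ℝ => (Pi.single i t : A → ℝ) :=
        continuous_single (A := fun _ : A => ℝ) i
      exact (WithLp.measurable_toLp 2 _).comp hc.measurable
    fun_prop
  · fun_prop
  · have e : (restr A y - EuclideanSpace.single i (y a - r y)) i = r y := by
      simp [restr, i]
    simp only [e]
    have e2 : r y / ε = ⌊y a / ε⌋ + φ y := by
      simp only [r]; field_simp
    rw [e2, Int.fract_intCast_add, Int.fract_eq_self.2 ⟨hv0 _, hv1 _⟩, hwv]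
    exact congrFun hdu _
  · rw [sub_sub_cancel, PiLp.norm_single, Real.norm_eq_abs]
    have e3 : y a - r y = ε * (Int.fract (y a / ε) - φ y) := by
      have := Int.floor_add_fract (y a / ε)
      have h2 : y a = ε * (⌊y a / ε⌋ + Int.fract (y a / ε)) := by
        rw [this]; field_simp
      simp only [r]
      linear_combination h2
    rw [e3, abs_mul, abs_of_pos hε]
    have h1 := Int.fract_nonneg (y a / ε)
    have h2 := Int.fract_lt_one (y a / ε)
    have h3 := hv0 (embeddingReal _ (restr Aᶜ y))
    have h4 := hv1 (embeddingReal _ (restr Aᶜ y))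
    have : |Int.fract (y a / ε) - φ y| ≤ 1 := by
      rw [abs_le]; constructor <;> simp only [φ] <;> linarith
    nlinarith

/-! ### Perturbation of the distortion -/

/-- Weighted AM-GM on the cross term, `2uv ≤ s u² + s⁻¹ v²`: for small `s` the main distortion keeps
a factor near 1. -/
lemma ofReal_norm_sub_sq_le {E : Type*} [SeminormedAddCommGroup E] (a b c : E) {s : ℝ}
    (hs : 0 < s) :
    ENNReal.ofReal (‖a - c‖ ^ 2) ≤ ENNReal.ofReal (1 + s) * ENNReal.ofReal (‖a - b‖ ^ 2) +
      ENNReal.ofReal (1 + s⁻¹) * ENNReal.ofReal (‖b - c‖ ^ 2) := by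
  rw [← ENNReal.ofReal_mul (by positivity), ← ENNReal.ofReal_mul (by positivity),
    ← ENNReal.ofReal_add (by positivity) (by positivity)]
  refine ENNReal.ofReal_le_ofReal ?_
  have h1 := norm_sub_le_norm_sub_add_norm_sub a b c
  have h2 := mul_self_le_mul_self (norm_nonneg _) h1
  have h3 : s * s⁻¹ = 1 := mul_inv_cancel₀ hs.ne'
  have h4 : 2 * (‖a - b‖ * ‖b - c‖) ≤ s * ‖a - b‖ ^ 2 + s⁻¹ * ‖b - c‖ ^ 2 := by
    have h5 : 0 ≤ s⁻¹ * (s * ‖a - b‖ - ‖b - c‖) ^ 2 := by positivity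
    have h6 : s⁻¹ * (s * ‖a - b‖ - ‖b - c‖) ^ 2 =
        s * ‖a - b‖ ^ 2 + s⁻¹ * ‖b - c‖ ^ 2 - 2 * (‖a - b‖ * ‖b - c‖) := by
      field_simp
      ring
    linarith
  nlinarith

/-- Of the gap `g = D - M`, at most `g/2` goes to the factor `1 + s` and `g/4` to the `ε` term. -/
lemma exists_slack {M D : ℝ≥0∞} (h : M < D) (hD : D ≠ ∞) :
    ∃ s : ℝ, 0 < s ∧ ∃ ε : ℝ, 0 < ε ∧
      ENNReal.ofReal (1 + s) * M + ENNReal.ofReal (1 + s⁻¹) * ENNReal.ofReal (ε ^ 2) < D := by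
  have hM : M ≠ ∞ := h.ne_top
  lift M to ℝ≥0 using hM
  lift D to ℝ≥0 using hD
  have h' : (M : ℝ) < D := by exact_mod_cast h
  have hM0 : (0 : ℝ) ≤ M := M.2
  set g : ℝ := D - M with hg
  have hg0 : 0 < g := by simp only [hg]; linarith
  -- The summand 1 keeps the divisor positive when `M = 0`.
  set s : ℝ := g / (2 * (M + 1)) with hs
  have hs0 : 0 < s := by positivity
  have hs1 : s * M ≤ g / 2 := by
    rw [hs, div_mul_eq_mul_div, div_le_div_iff₀ (by positivity) (by norm_num)]
    nlinarith
  refine ⟨s, hs0, Real.sqrt (g / (4 * (1 + s⁻¹))), Real.sqrt_pos.2 (by positivity), ?_⟩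
  rw [Real.sq_sqrt (by positivity), ← ENNReal.ofReal_mul (by positivity),
    ← ENNReal.ofReal_coe_nnreal, ← ENNReal.ofReal_mul (by positivity),
    ← ENNReal.ofReal_add (by positivity) (by positivity), ← ENNReal.ofReal_coe_nnreal]
  refine (ENNReal.ofReal_lt_ofReal_iff (by linarith)).2 ?_
  have e : (1 + s⁻¹) * (g / (4 * (1 + s⁻¹))) = g / 4 := by
    have : 1 + s⁻¹ ≠ 0 := by positivity
    field_simp
  rw [e]
  nlinarith

/-! ### Mixtures of channels -/

section Mixture

variable {E F : Type*} [MeasurableSpace E] [MeasurableSpace F]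

/-- The channel that uses `W` with weight `a` and `V` with weight `b`. -/
def mixKernel (a b : ℝ≥0) (W V : Kernel E F) : Kernel E F where
  toFun x := a • W x + b • V x
  measurable' := Measure.measurable_of_measurable_coe _ fun _ hs =>
    ((W.measurable_coe hs).const_mul (a : ℝ≥0∞)).add ((V.measurable_coe hs).const_mul (b : ℝ≥0∞))

lemma mixKernel_apply (a b : ℝ≥0) (W V : Kernel E F) (x : E) :
    mixKernel a b W V x = a • W x + b • V x := rfl

lemma isMarkovKernel_mixKernel {a b : ℝ≥0} (hab : a + b = 1) (W V : Kernel E F)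
    [IsMarkovKernel W] [IsMarkovKernel V] : IsMarkovKernel (mixKernel a b W V) := by
  refine ⟨fun x => ⟨?_⟩⟩
  rw [mixKernel_apply, Measure.add_apply, Measure.smul_apply, Measure.smul_apply, measure_univ,
    measure_univ, ENNReal.smul_def, ENNReal.smul_def, smul_eq_mul, smul_eq_mul, mul_one, mul_one]
  exact_mod_cast hab

lemma compProd_mixKernel {a b : ℝ≥0} (hab : a + b = 1) (μ : Measure E) [SFinite μ]
    (W V : Kernel E F) [IsMarkovKernel W] [IsMarkovKernel V] :
    μ ⊗ₘ mixKernel a b W V = a • (μ ⊗ₘ W) + b • (μ ⊗ₘ V) := by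
  have := isMarkovKernel_mixKernel hab W V
  refine Measure.ext_of_lintegral _ fun g hg => ?_
  have h1 : Measurable fun x => ∫⁻ y, g (x, y) ∂(W x) := hg.lintegral_kernel_prod_right'
  have h2 : Measurable fun x => ∫⁻ y, g (x, y) ∂(V x) := hg.lintegral_kernel_prod_right'
  rw [lintegral_add_measure, lintegral_smul_measure, lintegral_smul_measure,
    Measure.lintegral_compProd hg, Measure.lintegral_compProd hg, Measure.lintegral_compProd hg]
  simp only [mixKernel_apply, lintegral_add_measure, lintegral_smul_measure, ENNReal.smul_def,
    smul_eq_mul]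
  rw [lintegral_add_left (h1.const_mul _), lintegral_const_mul _ h1, lintegral_const_mul _ h2]

/-- For a fixed input law the product of the marginals is affine in the channel, so joint convexity
of the divergence applies. -/
lemma mutualInfo_mixKernel_le {a b : ℝ≥0} (hab : a + b = 1) (μ : Measure E)
    [IsProbabilityMeasure μ] (W V : Kernel E F) [IsMarkovKernel W] [IsMarkovKernel V] :
    mutualInfo (μ ⊗ₘ mixKernel a b W V) Prod.fst Prod.snd ≤
      a * mutualInfo (μ ⊗ₘ W) Prod.fst Prod.snd + b * mutualInfo (μ ⊗ₘ V) Prod.fst Prod.snd := by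
  have := isMarkovKernel_mixKernel hab W V
  have := isProbabilityMeasure_map_snd (μ ⊗ₘ W)
  have := isProbabilityMeasure_map_snd (μ ⊗ₘ V)
  simp only [mutualInfo_fst_snd, map_fst_compProd]
  have h : μ.prod ((μ ⊗ₘ mixKernel a b W V).map Prod.snd) =
      a • μ.prod ((μ ⊗ₘ W).map Prod.snd) + b • μ.prod ((μ ⊗ₘ V).map Prod.snd) := by
    rw [compProd_mixKernel hab, Measure.map_add _ _ measurable_snd, Measure.map_smul,
      Measure.map_smul, Measure.prod_add]
    simp only [ENNReal.smul_def, Measure.prod_smul_right]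
  rw [h, compProd_mixKernel hab, ← mul_div_assoc, ← mul_div_assoc, ← ENNReal.add_div]
  gcongr
  exact klDiv_convex a b

lemma jointAC_of_mutualInfo_ne_top {Q : Measure (E × F)}
    (h : mutualInfo Q Prod.fst Prod.snd ≠ ∞) : JointAC Q Prod.fst Prod.snd := by
  rw [jointAC_fst_snd]
  rw [mutualInfo_fst_snd] at h
  by_contra hac
  exact h (by rw [klDiv_of_not_ac hac, ENNReal.top_div_of_ne_top ENNReal.ofReal_ne_top])

lemma mutualInfo_deterministic_ne_top [MeasurableSingletonClass F] (μ : Measure E)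
    [IsProbabilityMeasure μ] (q : SimpleFunc E F) :
    mutualInfo (μ ⊗ₘ Kernel.deterministic q q.measurable) Prod.fst Prod.snd ≠ ∞ := by
  have hq := q.measurable
  rw [mutualInfo_fst_snd, map_fst_compProd, Measure.compProd_deterministic,
    Measure.map_map measurable_snd (by fun_prop)]
  refine ENNReal.div_ne_top (klDiv_map_simpleFunc_ne_top μ q) ?_
  rw [Ne, ENNReal.ofReal_eq_zero, not_le]
  exact Real.log_pos one_lt_two

end Mixture

/-! ### The distortion of a channel driven by the sampled components -/

lemma lintegral_jointLaw {A : Finset (Fin m)} {F : Type*} [MeasurableSpace F]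
    (W : Kernel (EuclideanSpace ℝ A) F) [IsMarkovKernel W] (τ : Matrix (Fin m) (Fin m) ℝ)
    {f : EuclideanSpace ℝ (Fin m) × F → ℝ≥0∞} (hf : Measurable f) :
    ∫⁻ p, f p ∂(jointLaw A W τ) =
      ∫⁻ x, ∫⁻ y, f (x, y) ∂(W (restr A x)) ∂(multivariateGaussian 0 τ) := by
  rw [jointLaw, Measure.lintegral_compProd hf]
  rfl

/-- Jensen's inequality, read off the bias-variance identity. An infinite right side is treated
apart, since the mean may then be the default value 0. -/
lemma ofReal_norm_sub_integral_sq_le {E : Type*} [NormedAddCommGroup E] [InnerProductSpace ℝ E]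
    [FiniteDimensional ℝ E] [MeasurableSpace E] [BorelSpace E] (ν : Measure E)
    [IsProbabilityMeasure ν] (y : E) :
    ENNReal.ofReal (‖y - ∫ z, z ∂ν‖ ^ 2) ≤ ∫⁻ z, ENNReal.ofReal (‖y - z‖ ^ 2) ∂ν := by
  by_cases h : ∫⁻ z, ENNReal.ofReal (‖y - z‖ ^ 2) ∂ν = ∞
  · rw [h]; exact le_top
  simp only [norm_sub_rev y] at h ⊢
  have := FiniteDimensional.proper ℝ E
  rw [lintegral_norm_sub_sq_eq (memLp_id_of_lintegral_lt_top (lt_top_iff_ne_top.2 h)) y]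
  exact le_add_self

-- Reduction of the nonBayesian problem

section NonBayes

variable {Θ : Set (Matrix (Fin m) (Fin m) ℝ)} {A : Finset (Fin m)} {τ₁ : Matrix A A ℝ}

/-- A finitely valued estimate of `X_M` from `X_A` whose distortion comes close to
`Δ_{min,A,τ₁}`, uniformly over the ambiguity atom. -/
lemma exists_simpleFunc_distortion_lt (hΘ_pd : ∀ τ ∈ Θ, τ.PosDef) (hτ₁ : τ₁ ∈ Theta1 A Θ)
    {D : ℝ≥0∞} (hδ : deltaMinNonBayes A Θ τ₁ < D) (hD : D ≠ ∞) :
    ∃ q : SimpleFunc (EuclideanSpace ℝ A) (EuclideanSpace ℝ (Fin m)), ∃ D' < D,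
      ∀ τ ∈ atom A Θ τ₁,
        ∫⁻ x, ENNReal.ofReal (‖x - q (restr A x)‖ ^ 2) ∂(multivariateGaussian 0 τ) ≤ D' := by
  have hres := measurable_restr A
  have hresc := measurable_restr Aᶜ
  have hglue := measurable_glue A
  obtain ⟨τ₀, hτ₀, rfl⟩ := hτ₁
  simp only [deltaMinNonBayes, iInf_lt_iff] at hδ
  obtain ⟨V, hV, hM⟩ := hδ
  set M := ⨆ τ ∈ atom A Θ (subCov A τ₀),
    ∫⁻ p, ENNReal.ofReal (‖restr Aᶜ p.1 - p.2‖ ^ 2) ∂(jointLaw A V τ)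
  have hgm : Measurable fun x => ∫ z, z ∂(V x) := by
    have h : StronglyMeasurable fun p : EuclideanSpace ℝ A × EuclideanSpace ℝ ↥(Aᶜ) => p.2 :=
      measurable_snd.stronglyMeasurable
    exact h.integral_kernel_prod_right'.measurable
  -- `X_A` is reproduced exactly and `X_{A^c}` is estimated by the mean of `V`, which by Jensen does
  -- no worse than `V` under any `τ`.
  let G : EuclideanSpace ℝ A → EuclideanSpace ℝ (Fin m) := fun x => glue A (x, ∫ z, z ∂(V x))
  have hG : Measurable G := by fun_prop
  have hdist : ∀ τ ∈ atom A Θ (subCov A τ₀),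
      ∫⁻ x, ENNReal.ofReal (‖x - G (restr A x)‖ ^ 2) ∂(multivariateGaussian 0 τ) ≤ M := by
    intro τ hτ
    refine le_trans ?_ (le_iSup₂ (f := fun τ (_ : τ ∈ atom A Θ (subCov A τ₀)) =>
      ∫⁻ p, ENNReal.ofReal (‖restr Aᶜ p.1 - p.2‖ ^ 2) ∂(jointLaw A V τ)) τ hτ)
    rw [lintegral_jointLaw _ _ (by fun_prop)]
    refine lintegral_mono fun x => ?_
    rw [norm_sub_sq_eq_restr A, restr_glue, restr_compl_glue, sub_self, norm_zero,
      zero_pow two_ne_zero, zero_add]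
    exact ofReal_norm_sub_integral_sq_le _ _
  have hmap : ∀ τ ∈ atom A Θ (subCov A τ₀),
      (multivariateGaussian 0 τ).map (restr A) = multivariateGaussian 0 (subCov A τ₀) :=
    fun τ hτ => by rw [map_restr_gaussian (hΘ_pd τ hτ.1).posSemidef, hτ.2]
  -- `X_M` and `X_M - G(X_A)` are square integrable under `N(0, τ₀)`. One point of the atom
  -- suffices, as the law of `X_A` is common to all.
  have hGL : MemLp G 2 (multivariateGaussian 0 (subCov A τ₀)) := by
    have h0 : τ₀ ∈ atom A Θ (subCov A τ₀) := ⟨hτ₀, rfl⟩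
    rw [← hmap τ₀ h0, memLp_map_measure_iff hG.aestronglyMeasurable hres.aemeasurable]
    have h1 : MemLp (fun x => x - G (restr A x)) 2 (multivariateGaussian 0 τ₀) := by
      rw [memLp_two_iff_integrable_sq_norm (by fun_prop)]
      refine ⟨by fun_prop, ?_⟩
      rw [hasFiniteIntegral_iff_ofReal (ae_of_all _ fun x => by positivity)]
      exact (hdist τ₀ h0).trans_lt (hM.trans_le le_top)
    have h2 := (IsGaussian.memLp_two_id
      (μ := multivariateGaussian (0 : EuclideanSpace ℝ (Fin m)) τ₀)).sub h1
    refine h2.ae_eq (ae_of_all _ fun x => ?_)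
    simp
  obtain ⟨s, hs, ε, hε, hlt⟩ := exists_slack hM hD
  -- The quantization error is measured under the common law of `X_A`, hence is uniform over the
  -- atom.
  obtain ⟨q, hq⟩ := exists_simpleFunc_lintegral_sq_sub_le hGL (ε := ENNReal.ofReal (ε ^ 2))
    (by rw [Ne, ENNReal.ofReal_eq_zero, not_le]; positivity)
  refine ⟨q, _, hlt, fun τ hτ => ?_⟩
  have hqm := q.measurable
  calc _ ≤ ∫⁻ x, ENNReal.ofReal (1 + s) * ENNReal.ofReal (‖x - G (restr A x)‖ ^ 2) +
          ENNReal.ofReal (1 + s⁻¹) * ENNReal.ofReal (‖G (restr A x) - q (restr A x)‖ ^ 2)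
          ∂(multivariateGaussian 0 τ) := lintegral_mono fun x => ofReal_norm_sub_sq_le _ _ _ hs
    _ = ENNReal.ofReal (1 + s) *
            ∫⁻ x, ENNReal.ofReal (‖x - G (restr A x)‖ ^ 2) ∂(multivariateGaussian 0 τ) +
          ENNReal.ofReal (1 + s⁻¹) * ∫⁻ x, ENNReal.ofReal (‖G x - q x‖ ^ 2)
            ∂(multivariateGaussian 0 (subCov A τ₀)) := by
      rw [lintegral_add_left (by fun_prop), lintegral_const_mul _ (by fun_prop),
        lintegral_const_mul _ (by fun_prop), ← hmap τ hτ, lintegral_map (by fun_prop) hres]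
    _ ≤ _ := by
      gcongr
      exact hdist τ hτ

/-- A channel whose distortion stays below `δ` uniformly can be replaced by a cascade that
satisfies the distortion constraint and carries no more information. -/
lemma exists_cascade_mutualInfo_le (hA : A.Nonempty) {δ : ℝ} {D : ℝ≥0∞}
    (hD : D < ENNReal.ofReal δ) (W : Kernel (EuclideanSpace ℝ A) (EuclideanSpace ℝ (Fin m)))
    [IsMarkovKernel W] (hW : JointAC (multivariateGaussian 0 τ₁ ⊗ₘ W) Prod.fst Prod.snd)
    (hdist : ∀ τ ∈ atom A Θ τ₁,
      ∫⁻ p, ENNReal.ofReal (‖p.1 - p.2‖ ^ 2) ∂(jointLaw A W τ) ≤ D) :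
    ∃ c ∈ nonBayesReduced A Θ τ₁ δ,
      mutualInfo (multivariateGaussian 0 τ₁ ⊗ₘ c.1) Prod.fst Prod.snd ≤
        mutualInfo (multivariateGaussian 0 τ₁ ⊗ₘ W) Prod.fst Prod.snd := by
  obtain ⟨s, hs, ε, hε, hlt⟩ := exists_slack hD ENNReal.ofReal_ne_top
  obtain ⟨enc, dec, henc, hdec, h⟩ := exists_encoding hA hε
  have hglue := measurable_glue A
  have hresc := measurable_restr Aᶜ
  have hmk : IsMarkovKernel (W.map enc) := Kernel.IsMarkovKernel.map _ henc
  have hmap : multivariateGaussian 0 τ₁ ⊗ₘ W.map enc =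
      (multivariateGaussian 0 τ₁ ⊗ₘ W).map (Prod.map id enc) := Measure.compProd_map henc
  -- The new `Y_A` is `enc Y_M`, from which `dec` recovers `Y_{A^c}` exactly; the only new error is
  -- at most `ε`, on the block `A`.
  refine ⟨(W.map enc, Kernel.deterministic dec hdec),
    ⟨hmk, inferInstance, ?_, fun τ hτ => ?_⟩, ?_⟩
  · rw [hmap]
    exact hW.map_snd henc
  · have hcas : ∫⁻ p, ENNReal.ofReal (‖p.1 - p.2‖ ^ 2)
        ∂(jointLaw A (cascade A (W.map enc) (Kernel.deterministic dec hdec)) τ) =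
        ∫⁻ p, ENNReal.ofReal (‖p.1 - glue A (enc p.2, restr Aᶜ p.2)‖ ^ 2) ∂(jointLaw A W τ) := by
      rw [lintegral_jointLaw _ _ (by fun_prop), lintegral_jointLaw _ _ (by fun_prop)]
      refine lintegral_congr fun x => ?_
      rw [lintegral_cascade _ _ _ (by fun_prop)]
      have hd : ∀ y, ∫⁻ z, ENNReal.ofReal (‖x - glue A (y, z)‖ ^ 2)
          ∂(Kernel.deterministic dec hdec y) = ENNReal.ofReal (‖x - glue A (y, dec y)‖ ^ 2) :=
        fun y => by rw [Kernel.lintegral_deterministic' _ (by fun_prop)]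
      simp only [hd]
      rw [Kernel.map_apply _ henc, lintegral_map (by fun_prop) henc]
      simp only [(h _).1]
    have herr : ∀ y, ‖y - glue A (enc y, restr Aᶜ y)‖ ^ 2 ≤ ε ^ 2 := fun y => by
      rw [norm_sub_sq_eq_restr A, restr_glue, restr_compl_glue, sub_self, norm_zero,
        zero_pow two_ne_zero, add_zero]
      exact pow_le_pow_left₀ (norm_nonneg _) (h y).2 2
    rw [hcas]
    have hprob : IsProbabilityMeasure (jointLaw A W τ) := by
      unfold jointLaw; infer_instance
    calc _ ≤ ∫⁻ p, ENNReal.ofReal (1 + s) * ENNReal.ofReal (‖p.1 - p.2‖ ^ 2) +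
          ENNReal.ofReal (1 + s⁻¹) * ENNReal.ofReal (ε ^ 2) ∂(jointLaw A W τ) := by
          refine lintegral_mono fun p => (ofReal_norm_sub_sq_le _ p.2 _ hs).trans ?_
          gcongr ?_ + ENNReal.ofReal (1 + s⁻¹) * ENNReal.ofReal ?_
          · exact le_rfl
          · exact herr p.2
      _ = ENNReal.ofReal (1 + s) * ∫⁻ p, ENNReal.ofReal (‖p.1 - p.2‖ ^ 2) ∂(jointLaw A W τ) +
          ENNReal.ofReal (1 + s⁻¹) * ENNReal.ofReal (ε ^ 2) := by
        rw [lintegral_add_left (by fun_prop), lintegral_const_mul _ (by fun_prop), lintegral_const,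
          measure_univ, mul_one]
      _ ≤ _ := by
        refine le_trans ?_ hlt.le
        gcongr
        exact hdist τ hτ
  · rw [hmap]
    exact mutualInfo_map_le henc

/-- The cascade gives one inequality. For the other, the encoding costs some distortion, so slack is
first created by mixing with a finite-information channel whose distortion is uniformly below `δ`.
-/
theorem rhoNonBayes_eq (hΘ_pd : ∀ τ ∈ Θ, τ.PosDef) (hA : A.Nonempty) (hτ₁ : τ₁ ∈ Theta1 A Θ)
    {δ : ℝ} (hδ : deltaMinNonBayes A Θ τ₁ < ENNReal.ofReal δ) :
    rhoNonBayes A Θ τ₁ δ = ⨅ c ∈ nonBayesReduced A Θ τ₁ δ,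
      mutualInfo (multivariateGaussian 0 τ₁ ⊗ₘ c.1) Prod.fst Prod.snd := by
  refine le_antisymm (le_iInf₂ fun c hc => ?_) (le_iInf₂ fun W hW => ?_)
  · obtain ⟨h1, h2, h3, h4⟩ := hc
    refine (iInf₂_le (cascade A c.1 c.2) ⟨inferInstance, h3.cascade c.2, h4⟩).trans ?_
    exact mutualInfo_cascade_le _ _ _
  · obtain ⟨hWm, hWac, hWd⟩ := hW
    set N := multivariateGaussian (0 : EuclideanSpace ℝ A) τ₁ with hN
    by_cases hI : mutualInfo (N ⊗ₘ W) Prod.fst Prod.snd = ∞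
    · rw [hI]; exact le_top
    obtain ⟨q, D', hD', hq⟩ := exists_simpleFunc_distortion_lt hΘ_pd hτ₁ hδ ENNReal.ofReal_ne_top
    have hJ := mutualInfo_deterministic_ne_top N q
    set V := Kernel.deterministic q q.measurable with hV
    have hmix : ∀ a b : ℝ≥0, a + b = 1 → b ≠ 0 →
        ⨅ c ∈ nonBayesReduced A Θ τ₁ δ, mutualInfo (N ⊗ₘ c.1) Prod.fst Prod.snd ≤
          a * mutualInfo (N ⊗ₘ W) Prod.fst Prod.snd +
            b * mutualInfo (N ⊗ₘ V) Prod.fst Prod.snd := by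
      intro a b hab hb
      have := isMarkovKernel_mixKernel hab W V
      have hle := mutualInfo_mixKernel_le hab N W V
      have hac : JointAC (N ⊗ₘ mixKernel a b W V) Prod.fst Prod.snd :=
        jointAC_of_mutualInfo_ne_top (ne_top_of_le_ne_top (by finiteness) hle)
      -- Any positive weight on `V` makes the distortion bound strict, uniformly over the atom.
      have hlt : a * ENNReal.ofReal δ + b * D' < ENNReal.ofReal δ := by
        calc _ < a * ENNReal.ofReal δ + b * ENNReal.ofReal δ := by
              refine ENNReal.add_lt_add_left (by finiteness) ?_
              exact ENNReal.mul_lt_mul_right (by simpa using hb) ENNReal.coe_ne_top hD'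
          _ = ENNReal.ofReal δ := by
            rw [← add_mul, ← ENNReal.coe_add, hab, ENNReal.coe_one, one_mul]
      obtain ⟨c, hc, hcI⟩ := exists_cascade_mutualInfo_le hA hlt (mixKernel a b W V) hac
        (Θ := Θ) fun τ hτ => by
          have hcomap : ∀ K : Kernel (EuclideanSpace ℝ A) (EuclideanSpace ℝ (Fin m)),
            IsMarkovKernel K → IsMarkovKernel (K.comap (restr A) (measurable_restr A)) :=
              fun K _ => inferInstance
          have e : jointLaw A (mixKernel a b W V) τ = a • jointLaw A W τ + b • jointLaw A V τ :=
            compProd_mixKernel hab _ (W.comap (restr A) (measurable_restr A))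
              (V.comap (restr A) (measurable_restr A))
          have hVd : ∫⁻ p, ENNReal.ofReal (‖p.1 - p.2‖ ^ 2) ∂(jointLaw A V τ) ≤ D' := by
            rw [lintegral_jointLaw _ _ (by fun_prop)]
            refine le_of_eq_of_le (lintegral_congr fun x => ?_) (hq τ hτ)
            rw [hV, Kernel.lintegral_deterministic' _ (by fun_prop)]
          rw [e, lintegral_add_measure, lintegral_smul_measure, lintegral_smul_measure,
            ENNReal.smul_def, ENNReal.smul_def, smul_eq_mul, smul_eq_mul]
          gcongr
          exact hWd τ hτ
      exact (iInf₂_le c hc).trans (hcI.trans hle)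
    lift mutualInfo (N ⊗ₘ V) Prod.fst Prod.snd to ℝ≥0 using hJ with j hj
    refine ENNReal.le_of_forall_pos_le_add fun ε hε _ => ?_
    -- Small enough that `V` contributes at most `ε` of information; the minimum with 1 makes `1 -
    -- b` a genuine complementary weight.
    set b : ℝ≥0 := min 1 (ε / (j + 1)) with hb
    have hb0 : b ≠ 0 := (lt_min one_pos (by positivity)).ne'
    have hbj : b * j ≤ ε := by
      calc b * j ≤ ε / (j + 1) * (j + 1) := by
            gcongr
            · exact min_le_right _ _
            · exact le_self_add
        _ = ε := div_mul_cancel₀ _ (by positivity)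
    refine (hmix (1 - b) b (tsub_add_cancel_of_le (min_le_left _ _)) hb0).trans ?_
    gcongr
    · exact mul_le_of_le_one_left' (by exact_mod_cast tsub_le_self)
    · exact_mod_cast hbj

end NonBayes

end USRD

end

theorem proposition2 {m : ℕ} (Θ : Set (Matrix (Fin m) (Fin m) ℝ))
    (hΘ_pd : ∀ τ ∈ Θ, τ.PosDef) (hΘ_convex : Convex ℝ Θ) (hΘ_compact : IsCompact Θ)
    (A : Finset (Fin m)) (hA : A.Nonempty)
    (τ₁ : Matrix A A ℝ) (hτ₁ : τ₁ ∈ USRD.Theta1 A Θ) (δ : ℝ) :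
    -- Bayesian setting: `θ` has law `μ` on `Θ`, and `κ` is its conditional law given `θ₁`
    (∀ (μ : MeasureTheory.Measure (Matrix (Fin m) (Fin m) ℝ))
      [MeasureTheory.IsProbabilityMeasure μ] (_ : ∀ᵐ τ ∂μ, τ ∈ Θ)
      (κ : ProbabilityTheory.Kernel (Matrix A A ℝ) (Matrix (Fin m) (Fin m) ℝ))
      [ProbabilityTheory.IsMarkovKernel κ] (_ : USRD.IsCondLaw A Θ μ κ),
      USRD.deltaMinBayes A (κ τ₁) < ENNReal.ofReal δ →
        IsLeast ((fun P => USRD.bayesInfo A P) '' USRD.bayesFeasible A (κ τ₁) δ)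
          (USRD.rhoBayes A (κ τ₁) δ) ∧
        IsLeast ((fun Q => USRD.mutualInfo Q Prod.fst Prod.snd) ''
            USRD.bayesReduced A (κ τ₁) τ₁ δ)
          (USRD.rhoBayes A (κ τ₁) δ)) ∧
    -- nonBayesian setting
    (USRD.deltaMinNonBayes A Θ τ₁ < ENNReal.ofReal δ →
      USRD.rhoNonBayes A Θ τ₁ δ =
        ⨅ c ∈ USRD.nonBayesReduced A Θ τ₁ δ,
          USRD.mutualInfo (ProbabilityTheory.multivariateGaussian 0 τ₁ ⊗ₘ c.1)
            Prod.fst Prod.snd) := by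
  refine ⟨fun μ _ _ κ _ hκ hδ => ?_, USRD.rhoNonBayes_eq hΘ_pd hA hτ₁⟩
  have hpd : τ₁.PosDef := by
    obtain ⟨τ₀, hτ₀, rfl⟩ := hτ₁
    exact USRD.posDef_subCov (hΘ_pd τ₀ hτ₀) A
  exact USRD.bayes_isLeast hΘ_pd hΘ_compact hpd (hκ.2 τ₁ hτ₁) hδ
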